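/- Work on $L^2(\mathbb R)$ ($\hbar=1$) with position and momentum operators $Q$, $P=-i\,d/dx$, ladder operators $a=\frac1{\sqrt2}(Q+iP)$, $a^\dagger=\frac1{\sqrt2}(Q-iP)$, number operator $N=a^\dagger a$, parity $(-1)^N\psi(x)=\psi(-x)$, and displacement operators $D(\alpha)=\exp(\alpha a^\dagger-\alpha^* a)$; explicitly, for $\alpha=\frac{1}{\sqrt2}(q+ip)$, $(D(\alpha)\psi)(x)=e^{ip(x-q/2)}\psi(x-q)$. Fix a real normalization constant $c$ (common choices are $c=\frac1{2\pi}$ and $c=\frac1\pi$; for the latter the operator of the whole plane is the identity). The Wigner operators are $W(q,p)=c\,D(\alpha)(-1)^N D(\alpha)^\dagger$ with $\alpha=\frac{1}{\sqrt2}(q+ip)$, the Wigner function of $\psi$ is $W_\psi(q,p)=\langle\psi|W(q,p)|\psi\rangle$, the region operator of a phase space region $S$ of finite area is $K_S=\int_S W(q,p)\,dq\,dp$ (a strong integral), and the quasiprobability volume of $S$ in the state $\psi$ is $\int_S W_\psi(q,p)\,dq\,dp$. For $x_0,k_0\in\mathbb R$ and $A,B\ge 0$ let $K(x_0,k_0;A,B)$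 be the region operator of the rectangle $[x_0,x_0+A]\times[k_0,k_0+B]$ (position $\times$ momentum). (i) With $\operatorname{erf}(z)=\frac2{\sqrt\pi}\int_0^z e^{-u^2}du$ on $\mathbb C$, the normally ordered form of the rectangle operator is $$K(x_0,k_0;A,B)=\frac{c\pi}{4}:\Big[\operatorname{erf}\big(-\tfrac1{\sqrt2}(a^\dagger+a)+x_0+A\big)-\operatorname{erf}\big(-\tfrac1{\sqrt2}(a^\dagger+a)+x_0\big)\Big]\Big[\operatorname{erf}\big(-\tfrac i{\sqrt2}(a^\dagger-a)+k_0+B\big)-\operatorname{erf}\big(-\tfrac i{\sqrt2}(a^\dagger-a)+k_0\big)\Big]:$$ (so the constant is $\frac18$ for $c=\frac1{2\pi}$ and $\frac14$ for $c=\frac1\pi$). Here $K=\,:F(a^\dagger,a):$ means that $F(\zeta,w)=\sum_{m,n}f_{mn}\zeta^m w^n$ is an absolutely convergent power series on $\mathbb C^2$ and $\langle\varphi|K|\psi\rangle=\sum_{m,n}f_{mn}\langle a^m\varphi|a^n\psi\rangle$, absolutely convergent, for all finite linear combinations $\varphi,\psi$ of number states and coherent states. (ii) For all $s,t\in\mathbb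 R$ the operator $D=D\big(\frac{s+it}{\sqrt2}\big)$ is unitary and $$D\,K(x_0,k_0;A,B)\,D^\dagger=K(x_0+s,k_0+t;A,B).$$ Hence the two rectangle operators are isospectral: they have the same spectrum, and for every $\mu\in\mathbb C$, $D$ maps the eigenspace of $K(x_0,k_0;A,B)$ for $\mu$ onto that of $K(x_0+s,k_0+t;A,B)$, so all eigenvalues agree with their multiplicities. They also have the same quasiprobability volumes: the quasiprobability volume of the rectangle in the state $\psi$ equals $\langle\psi|K(x_0,k_0;A,B)|\psi\rangle$; the volume of the shifted rectangle in the state $D\psi$ equals the volume of the original rectangle in the state $\psi$, for every $\psi$; and the sets of values of the two volumes over all unit vectors $\psi$ coincide. -/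

import Mathlib

open MeasureTheory Complex Filter Topology
open scoped InnerProductSpace SchwartzMap ENNReal

noncomputable section

namespace RegionOp

/-! ### The Hilbert space `L²(ℝ)` and the displacement operators -/

/-- The Hilbert space of one quantum mechanical degree of freedom, `L²(ℝ; ℂ)` (`ħ = 1`). -/
abbrev H : Type := Lp ℂ 2 (volume : Measure ℝ)

/-- Composition `ψ ↦ ψ(· - q)`. -/
def translation (q : ℝ) : H →ₗᵢ[ℂ] H :=
  Lp.compMeasurePreservingₗᵢ ℂ (fun x : ℝ => x - q) (measurePreserving_sub_right volume q)

/-- The parity operator `(Πψ)(x) = ψ(-x)`, i.e. `(-1)^N` with `N` the number operator. -/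
def parity : H →L[ℂ] H :=
  (Lp.compMeasurePreservingₗᵢ ℂ (fun x : ℝ => -x)
    (Measure.measurePreserving_neg volume)).toContinuousLinearMap

theorem norm_parity (ψ : H) : ‖parity ψ‖ = ‖ψ‖ :=
  (Lp.compMeasurePreservingₗᵢ ℂ (fun x : ℝ => -x)
    (Measure.measurePreserving_neg volume)).norm_map ψ

/-- The phase `e^{i p (x - q/2)}`. -/
def phase (q p x : ℝ) : ℂ := Complex.exp (((p * (x - q / 2) : ℝ) : ℂ) * I)

theorem norm_phase (q p x : ℝ) : ‖phase q p x‖ = 1 := Complex.norm_exp_ofReal_mul_I _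

theorem continuous_phase (q p : ℝ) : Continuous (phase q p) := by
  unfold phase; fun_prop

theorem memLp_phase_mul (q p : ℝ) (ψ : H) :
    MemLp (fun x => phase q p x * ψ x) 2 (volume : Measure ℝ) := by
  refine (Lp.memLp ψ).of_le
    ((continuous_phase q p).aestronglyMeasurable.mul (Lp.aestronglyMeasurable ψ)) ?_
  exact Eventually.of_forall fun x => by simp [norm_phase]

/-- Multiplication of a wave function by the phase `e^{i p (x - q/2)}`. -/
def modulation (q p : ℝ) : H →ₗᵢ[ℂ] H where
  toFun ψ := (memLp_phase_mul q p ψ).toLp _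
  map_add' ψ φ := by
    rw [← MemLp.toLp_add]
    refine MemLp.toLp_congr _ _ ?_
    filter_upwards [Lp.coeFn_add ψ φ] with x hx
    rw [hx, Pi.add_apply, mul_add]
    rfl
  map_smul' c ψ := by
    rw [RingHom.id_apply, ← MemLp.toLp_const_smul]
    refine MemLp.toLp_congr _ _ ?_
    filter_upwards [Lp.coeFn_smul c ψ] with x hx
    simp [hx, mul_left_comm]
  norm_map' ψ := by
    refine le_antisymm ?_ ?_ <;>
    · refine Lp.norm_le_norm_of_ae_le ?_
      filter_upwards [(memLp_phase_mul q p ψ).coeFn_toLp] with x hx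
      simp [hx, norm_phase]

/-- The displacement operator with position shift `q` and momentum shift `p`, that is
`D(q,p) = exp (i (p Q - q P))`; in the Schrödinger representation
`(D(q,p) ψ)(x) = e^{i p (x - q/2)} ψ(x - q)`. -/
def displacementQP (q p : ℝ) : H →L[ℂ] H :=
  ((modulation q p).comp (translation q)).toContinuousLinearMap

/-- The displacement operator `D(α) = exp (α a† - α* a)`, `α = (q + i p) / √2`. -/
def displacement (α : ℂ) : H →L[ℂ] H :=
  displacementQP (Real.sqrt 2 * α.re) (Real.sqrt 2 * α.im)

theorem displacementQP_coeFn (q p : ℝ) (ψ : H) :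
    displacementQP q p ψ =ᵐ[volume] fun x => phase q p x * ψ (x - q) := by
  have h1 : displacementQP q p ψ =ᵐ[volume] fun x => phase q p x * (translation q ψ) x :=
    MemLp.coeFn_toLp (memLp_phase_mul q p (translation q ψ))
  have h2 : (translation q ψ : ℝ → ℂ) =ᵐ[volume] ψ ∘ (fun x : ℝ => x - q) :=
    Lp.coeFn_compMeasurePreserving ψ (measurePreserving_sub_right volume q)
  filter_upwards [h1, h2] with x hx1 hx2
  rw [hx1, hx2, Function.comp_apply]

theorem norm_displacementQP (q p : ℝ) (ψ : H) : ‖displacementQP q p ψ‖ = ‖ψ‖ :=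
  ((modulation q p).comp (translation q)).norm_map ψ

theorem displacementQP_neg_comp (q p : ℝ) (ψ : H) :
    displacementQP (-q) (-p) (displacementQP q p ψ) = ψ := by
  refine Lp.ext ?_
  have h1 := displacementQP_coeFn (-q) (-p) (displacementQP q p ψ)
  have h2 := (measurePreserving_sub_right (volume : Measure ℝ) (-q)).quasiMeasurePreserving.ae_eq
    (displacementQP_coeFn q p ψ)
  filter_upwards [h1, h2] with x hx1 hx2
  simp only [Function.comp_apply] at hx2
  rw [hx1, hx2]
  have : phase (-q) (-p) x * phase q p (x - -q) = 1 := by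
    unfold phase
    rw [← Complex.exp_add, ← Complex.exp_zero]
    congr 1
    push_cast
    ring
  rw [← mul_assoc, this, one_mul]
  congr 1
  ring

theorem adjoint_displacementQP (q p : ℝ) :
    ContinuousLinearMap.adjoint (displacementQP q p) = displacementQP (-q) (-p) := by
  have h : ContinuousLinearMap.adjoint (displacementQP q p) ∘L displacementQP q p = 1 :=
    (ContinuousLinearMap.norm_map_iff_adjoint_comp_self _).1 (norm_displacementQP q p)
  ext1 ψ
  have h2 := displacementQP_neg_comp (-q) (-p) ψ
  rw [neg_neg, neg_neg] at h2
  conv_lhs => rw [← h2]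
  exact congrArg (fun T : H →L[ℂ] H => T (displacementQP (-q) (-p) ψ)) h

theorem continuous_modulation (χ : H) :
    Continuous fun y : ℝ × ℝ => modulation y.1 y.2 χ := by
  have key : ∀ y₀ : ℝ × ℝ, Continuous fun y : ℝ × ℝ =>
      ⟪modulation y₀.1 y₀.2 χ, modulation y.1 y.2 χ⟫_ℂ := by
    intro y₀
    have hrw : ∀ y : ℝ × ℝ, ⟪modulation y₀.1 y₀.2 χ, modulation y.1 y.2 χ⟫_ℂ =
        ∫ x : ℝ, ⟪phase y₀.1 y₀.2 x * χ x, phase y.1 y.2 x * χ x⟫_ℂ := by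
      intro y
      rw [L2.inner_def]
      refine integral_congr_ae ?_
      filter_upwards [(memLp_phase_mul y₀.1 y₀.2 χ).coeFn_toLp,
        (memLp_phase_mul y.1 y.2 χ).coeFn_toLp] with x h1 h2
      exact congrArg₂ (fun u v : ℂ => ⟪u, v⟫_ℂ) h1 h2
    simp only [hrw]
    refine continuous_of_dominated (bound := fun x => ‖χ x‖ ^ 2) ?_ ?_ ?_ ?_
    · intro y
      exact (memLp_phase_mul y₀.1 y₀.2 χ).aestronglyMeasurable.inner
        (memLp_phase_mul y.1 y.2 χ).aestronglyMeasurable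
    · intro y
      refine Eventually.of_forall fun x => (norm_inner_le_norm _ _).trans (le_of_eq ?_)
      rw [norm_mul, norm_mul, norm_phase, norm_phase]
      ring
    · exact (memLp_two_iff_integrable_sq_norm (Lp.aestronglyMeasurable χ)).1 (Lp.memLp χ)
    · refine Eventually.of_forall fun x => ?_
      unfold phase
      fun_prop
  rw [continuous_iff_continuousAt]
  intro y₀
  refine tendsto_iff_norm_sub_tendsto_zero.2 ?_
  have h1 : Tendsto (fun y : ℝ × ℝ => ‖modulation y.1 y.2 χ - modulation y₀.1 y₀.2 χ‖ ^ 2)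
      (𝓝 y₀) (𝓝 0) := by
    have h2 : ∀ y : ℝ × ℝ, ‖modulation y.1 y.2 χ - modulation y₀.1 y₀.2 χ‖ ^ 2 =
        2 * ‖χ‖ ^ 2 - 2 * (⟪modulation y₀.1 y₀.2 χ, modulation y.1 y.2 χ⟫_ℂ).re := by
      intro y
      rw [norm_sub_rev, @norm_sub_sq ℂ, LinearIsometry.norm_map, LinearIsometry.norm_map]
      simp only [RCLike.re_eq_complex_re]
      ring
    have h3 : Tendsto (fun y : ℝ × ℝ => 2 * ‖χ‖ ^ 2 -
        2 * (⟪modulation y₀.1 y₀.2 χ, modulation y.1 y.2 χ⟫_ℂ).re) (𝓝 y₀)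
        (𝓝 (2 * ‖χ‖ ^ 2 - 2 * (⟪modulation y₀.1 y₀.2 χ, modulation y₀.1 y₀.2 χ⟫_ℂ).re)) :=
      (Continuous.tendsto (by have := key y₀; fun_prop) y₀)
    rw [← h2 y₀, sub_self, norm_zero] at h3
    simp only [h2]
    simpa using h3
  have h4 := h1.sqrt
  simpa [Real.sqrt_sq (norm_nonneg _)] using h4

theorem continuous_displacementQP (ψ : H) :
    Continuous fun y : ℝ × ℝ => displacementQP y.1 y.2 ψ := by
  have hT : Continuous fun y : ℝ × ℝ => translation y.1 ψ := by
    have hg : Continuous fun y : ℝ × ℝ => (⟨fun x : ℝ => x - y.1, by fun_prop⟩ : C(ℝ, ℝ)) :=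
      ContinuousMap.continuous_of_continuous_uncurry _ (by
        simp only [Function.uncurry_def, ContinuousMap.coe_mk]; fun_prop)
    exact (continuous_const (y := ψ)).compMeasurePreservingLp hg
      (fun y => measurePreserving_sub_right volume y.1) (by simp)
  rw [continuous_iff_continuousAt]
  intro y₀
  have hM := (continuous_modulation (translation y₀.1 ψ)).tendsto y₀
  have hd : Tendsto (fun y : ℝ × ℝ => modulation y.1 y.2 (translation y.1 ψ - translation y₀.1 ψ))
      (𝓝 y₀) (𝓝 0) := by
    rw [tendsto_zero_iff_norm_tendsto_zero]
    simp only [LinearIsometry.norm_map]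
    exact tendsto_iff_norm_sub_tendsto_zero.1 (hT.tendsto y₀)
  have := hd.add hM
  rw [zero_add] at this
  refine Tendsto.congr (fun y => ?_) this
  rw [← map_add, sub_add_cancel]
  rfl

/-! ### Wigner operators, Wigner function, region operators -/

/-- The Wigner operator `W(q,p) = c D(α) (-1)^N D(α)†`, `α = (q + i p) / √2`, where the real number
`c` fixes the normalization. -/
def wignerOperator (c : ℝ) (y : ℝ × ℝ) : H →L[ℂ] H :=
  (c : ℂ) • (displacement ((y.1 + I * y.2) / Real.sqrt 2) ∘L parity ∘L
    ContinuousLinearMap.adjoint (displacement ((y.1 + I * y.2) / Real.sqrt 2)))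

theorem displacement_eq (q p : ℝ) :
    displacement ((q + I * p) / Real.sqrt 2) = displacementQP q p := by
  have h : (Real.sqrt 2) ≠ 0 := by positivity
  unfold displacement
  congr 1 <;> · simp [Complex.div_ofReal_re, Complex.div_ofReal_im]; field_simp

theorem continuous_displacementQP_apply {g : ℝ × ℝ → H} (hg : Continuous g) :
    Continuous fun y : ℝ × ℝ => displacementQP y.1 y.2 (g y) := by
  rw [continuous_iff_continuousAt]
  intro y₀
  have hM := (continuous_displacementQP (g y₀)).tendsto y₀
  have hd : Tendsto (fun y : ℝ × ℝ => displacementQP y.1 y.2 (g y - g y₀)) (𝓝 y₀) (𝓝 0) := by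
    rw [tendsto_zero_iff_norm_tendsto_zero]
    simp only [norm_displacementQP]
    exact tendsto_iff_norm_sub_tendsto_zero.1 (hg.tendsto y₀)
  have := hd.add hM
  rw [zero_add] at this
  refine Tendsto.congr (fun y => ?_) this
  rw [← map_add, sub_add_cancel]

theorem wignerOperator_apply (c : ℝ) (y : ℝ × ℝ) (ψ : H) : wignerOperator c y ψ =
    (c : ℂ) • displacementQP y.1 y.2 (parity (displacementQP (-y.1) (-y.2) ψ)) := by
  rw [wignerOperator, displacement_eq, adjoint_displacementQP]
  rfl

theorem continuous_wignerOperator (c : ℝ) (ψ : H) :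
    Continuous fun y : ℝ × ℝ => wignerOperator c y ψ := by
  have h0 : Continuous fun y : ℝ × ℝ => (-y.1, -y.2) := by fun_prop
  have h1 : Continuous fun y : ℝ × ℝ => displacementQP (-y.1) (-y.2) ψ := by
    have := (continuous_displacementQP ψ).comp h0
    simpa only [Function.comp_def] using this
  have h2 : Continuous fun y : ℝ × ℝ => parity (displacementQP (-y.1) (-y.2) ψ) := by
    have := parity.continuous.comp h1
    simpa only [Function.comp_def] using this
  have h3 := (continuous_displacementQP_apply h2).const_smul (c : ℂ)
  exact h3.congr fun y => (wignerOperator_apply c y ψ).symm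

theorem norm_wignerOperator_le (c : ℝ) (y : ℝ × ℝ) (ψ : H) :
    ‖wignerOperator c y ψ‖ ≤ |c| * ‖ψ‖ := by
  rw [wignerOperator_apply, norm_smul, norm_displacementQP, norm_parity, norm_displacementQP, Complex.norm_real,
    Real.norm_eq_abs]

theorem integrableOn_wignerOperator (c : ℝ) {S : Set (ℝ × ℝ)} (hS : volume S ≠ ∞) (ψ : H) :
    IntegrableOn (fun y => wignerOperator c y ψ) S := by
  have : IsFiniteMeasure ((volume : Measure (ℝ × ℝ)).restrict S) :=
    ⟨by rw [Measure.restrict_apply_univ]; exact hS.lt_top⟩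
  exact Integrable.of_bound (continuous_wignerOperator c ψ).aestronglyMeasurable (|c| * ‖ψ‖)
    (Eventually.of_forall fun y => norm_wignerOperator_le c y ψ)

/-- The region operator `K_S = ∫_S W(q,p) dq dp` of a phase space region `S` of finite area (the
integral of operators is taken in the strong sense). -/
def regionOperator (c : ℝ) (S : Set (ℝ × ℝ)) (hS : volume S ≠ ∞) : H →L[ℂ] H :=
  LinearMap.mkContinuous
    { toFun := fun ψ => ∫ y in S, wignerOperator c y ψ
      map_add' := fun ψ φ => by
        simp only [map_add]
        exact integral_add (integrableOn_wignerOperator c hS ψ)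
          (integrableOn_wignerOperator c hS φ)
      map_smul' := fun z ψ => by
        simp only [map_smul, RingHom.id_apply]
        exact integral_smul z _ }
    (|c| * (volume S).toReal) (fun ψ => by
      have := norm_setIntegral_le_of_norm_le_const (μ := (volume : Measure (ℝ × ℝ)))
        hS.lt_top (fun y _ => norm_wignerOperator_le c y ψ)
      simp only [LinearMap.coe_mk, AddHom.coe_mk]
      refine this.trans (le_of_eq ?_)
      rw [Measure.real]
      ring)

/-- The Wigner function `W_ψ(q,p) = ⟨ψ| W(q,p) |ψ⟩` of a wave function. -/
def wignerFunction (c : ℝ) (ψ : H) (y : ℝ × ℝ) : ℝ := (⟪ψ, wignerOperator c y ψ⟫_ℂ).re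

/-- The quasiprobability volume of the region `S` in the state `ψ`: the integral of the Wigner
function of `ψ` over `S`. -/
def quasiprobabilityVolume (c : ℝ) (S : Set (ℝ × ℝ)) (ψ : H) : ℝ :=
  ∫ y in S, wignerFunction c ψ y

/-- The rectangle with lower left corner `(x₀, k₀)` and sides `A` (position), `B` (momentum). -/
def rectangle (x₀ k₀ A B : ℝ) : Set (ℝ × ℝ) :=
  Set.Icc x₀ (x₀ + A) ×ˢ Set.Icc k₀ (k₀ + B)

theorem volume_rectangle_ne_top (x₀ k₀ A B : ℝ) : volume (rectangle x₀ k₀ A B) ≠ ∞ := by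
  rw [rectangle, Measure.volume_eq_prod, Measure.prod_prod, Real.volume_Icc, Real.volume_Icc]
  exact ENNReal.mul_ne_top ENNReal.ofReal_ne_top ENNReal.ofReal_ne_top

/-- The rectangle region operator `K(x₀, k₀; A, B)`. -/
def rectangleOperator (c x₀ k₀ A B : ℝ) : H →L[ℂ] H :=
  regionOperator c (rectangle x₀ k₀ A B) (volume_rectangle_ne_top x₀ k₀ A B)

/-! ### Ladder operators, number states, coherent states -/

/-- The position operator on Schwartz functions. -/
def position : 𝓢(ℝ, ℂ) →ₗ[ℂ] 𝓢(ℝ, ℂ) :=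
  (SchwartzMap.smulLeftCLM ℂ (fun x : ℝ => (x : ℂ))).toLinearMap

/-- The momentum operator `-i d/dx` on Schwartz functions. -/
def momentum : 𝓢(ℝ, ℂ) →ₗ[ℂ] 𝓢(ℝ, ℂ) :=
  (-I) • (SchwartzMap.derivCLM ℂ ℂ).toLinearMap

/-- The annihilation operator `a = (Q + i P) / √2`. -/
def annihilation : 𝓢(ℝ, ℂ) →ₗ[ℂ] 𝓢(ℝ, ℂ) :=
  ((Real.sqrt 2 : ℂ)⁻¹) • (position + I • momentum)

/-- The creation operator `a† = (Q - i P) / √2`. -/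
def creation : 𝓢(ℝ, ℂ) →ₗ[ℂ] 𝓢(ℝ, ℂ) :=
  ((Real.sqrt 2 : ℂ)⁻¹) • (position - I • momentum)

theorem contDiff_gaussian (b : ℂ) : ContDiff ℝ (⊤ : ℕ∞)
    fun x : ℝ => Complex.exp (-(1 / 2) * (x : ℂ) ^ 2 + b * x) := by
  have : ContDiff ℝ (⊤ : ℕ∞) fun x : ℝ => (x : ℂ) := Complex.ofRealCLM.contDiff
  fun_prop

theorem bounded_mul_gaussian (b : ℂ) (k : ℕ) : ∃ C : ℝ, ∀ x : ℝ,
    |x| ^ k * ‖Complex.exp (-(1 / 2) * (x : ℂ) ^ 2 + b * x)‖ ≤ C := by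
  have h := cexp_neg_quadratic_isLittleO_abs_rpow_cocompact (a := -(1 / 2)) (by norm_num) b (-k)
  have ht : Tendsto (fun x : ℝ => |x| ^ k * ‖Complex.exp (-(1 / 2) * (x : ℂ) ^ 2 + b * x)‖)
      (cocompact ℝ) (𝓝 0) := by
    have h0 := h.norm_left.tendsto_div_nhds_zero
    refine h0.congr fun x => ?_
    rw [Real.rpow_neg (abs_nonneg x), Real.rpow_natCast, div_inv_eq_mul, mul_comm]
  have hc : Continuous fun x : ℝ => |x| ^ k * ‖Complex.exp (-(1 / 2) * (x : ℂ) ^ 2 + b * x)‖ := by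
    fun_prop
  let f : ZeroAtInftyContinuousMap ℝ ℝ := ⟨⟨_, hc⟩, ht⟩
  obtain ⟨C, hC⟩ := isBounded_iff_forall_norm_le.1 f.isBounded_range
  exact ⟨C, fun x => (le_abs_self _).trans (hC _ ⟨x, rfl⟩)⟩

theorem bounded_poly_gaussian (b : ℂ) (P : Polynomial ℂ) (k : ℕ) : ∃ C : ℝ, ∀ x : ℝ,
    |x| ^ k * ‖P.eval (x : ℂ) * Complex.exp (-(1 / 2) * (x : ℂ) ^ 2 + b * x)‖ ≤ C := by
  induction P using Polynomial.induction_on' with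
  | add P R hP hR =>
    obtain ⟨C, hC⟩ := hP
    obtain ⟨D, hD⟩ := hR
    refine ⟨C + D, fun x => le_trans ?_ (add_le_add (hC x) (hD x))⟩
    rw [← mul_add, Polynomial.eval_add, add_mul]
    gcongr
    exact norm_add_le _ _
  | monomial n z =>
    obtain ⟨C, hC⟩ := bounded_mul_gaussian b (k + n)
    refine ⟨‖z‖ * C, fun x => le_trans (le_of_eq ?_) (mul_le_mul_of_nonneg_left (hC x) (norm_nonneg z))⟩
    rw [Polynomial.eval_monomial, norm_mul, norm_mul, norm_pow, Complex.norm_real,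
      Real.norm_eq_abs]
    ring

theorem iteratedDeriv_gaussian (b : ℂ) (n : ℕ) : ∃ P : Polynomial ℂ,
    iteratedDeriv n (fun x : ℝ => Complex.exp (-(1 / 2) * (x : ℂ) ^ 2 + b * x)) =
      fun x : ℝ => P.eval (x : ℂ) * Complex.exp (-(1 / 2) * (x : ℂ) ^ 2 + b * x) := by
  induction n with
  | zero => exact ⟨1, by simp⟩
  | succ n ih =>
    obtain ⟨P, hP⟩ := ih
    refine ⟨Polynomial.derivative P + P * (Polynomial.C b - Polynomial.X), ?_⟩
    rw [iteratedDeriv_succ, hP]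
    funext x
    have h1 : HasDerivAt (fun z : ℂ => P.eval z * Complex.exp (-(1 / 2) * z ^ 2 + b * z))
        (P.derivative.eval (x : ℂ) * Complex.exp (-(1 / 2) * (x : ℂ) ^ 2 + b * x) +
          P.eval (x : ℂ) * (Complex.exp (-(1 / 2) * (x : ℂ) ^ 2 + b * x) *
            (-(1 / 2) * (2 * (x : ℂ)) + b * 1))) (x : ℂ) := by
      refine (P.hasDerivAt _).mul (HasDerivAt.cexp ?_)
      refine HasDerivAt.add (HasDerivAt.const_mul _ ?_) ((hasDerivAt_id _).const_mul b)
      simpa using hasDerivAt_pow 2 (x : ℂ)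
    rw [h1.comp_ofReal.deriv]
    simp only [Polynomial.eval_add, Polynomial.eval_mul, Polynomial.eval_sub, Polynomial.eval_C,
      Polynomial.eval_X]
    ring

theorem decay_gaussian (b : ℂ) (k n : ℕ) : ∃ C : ℝ, ∀ x : ℝ,
    ‖x‖ ^ k * ‖iteratedFDeriv ℝ n
      (fun x : ℝ => Complex.exp (-(1 / 2) * (x : ℂ) ^ 2 + b * x)) x‖ ≤ C := by
  obtain ⟨P, hP⟩ := iteratedDeriv_gaussian b n
  obtain ⟨C, hC⟩ := bounded_poly_gaussian b P k
  refine ⟨C, fun x => ?_⟩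
  rw [norm_iteratedFDeriv_eq_norm_iteratedDeriv, hP]
  exact hC x

/-- The Gaussian `x ↦ e^{-x²/2 + b x}` as a Schwartz function. -/
def gaussian (b : ℂ) : 𝓢(ℝ, ℂ) where
  toFun x := Complex.exp (-(1 / 2) * (x : ℂ) ^ 2 + b * x)
  smooth' := contDiff_gaussian b
  decay' := decay_gaussian b

/-- The vacuum state `π^{-1/4} e^{-x²/2}`. -/
def vacuum : 𝓢(ℝ, ℂ) := ((Real.pi ^ (-(1 / 4) : ℝ) : ℝ) : ℂ) • gaussian 0

/-- The number state `|n⟩ = (n!)^{-1/2} (a†)ⁿ |0⟩`. -/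
def numberState (n : ℕ) : 𝓢(ℝ, ℂ) :=
  ((Real.sqrt n.factorial : ℂ)⁻¹) • (creation ^ n) vacuum

/-- The coherent state `|z⟩ = D(z)|0⟩`, whose wave function is
`π^{-1/4} e^{-x²/2 + √2 z x - z²/2 - |z|²/2}`. -/
def coherentState (z : ℂ) : 𝓢(ℝ, ℂ) :=
  (((Real.pi ^ (-(1 / 4) : ℝ) : ℝ) : ℂ) * Complex.exp (-(z ^ 2) / 2 - (‖z‖ : ℂ) ^ 2 / 2)) •
    gaussian (Real.sqrt 2 * z)

/-- The finite linear combinations of number states and coherent states. -/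
def fockDomain : Submodule ℂ 𝓢(ℝ, ℂ) :=
  Submodule.span ℂ (Set.range numberState ∪ Set.range coherentState)

/-- A Schwartz function as a vector of the Hilbert space. -/
def ket (φ : 𝓢(ℝ, ℂ)) : H := φ.toLp 2 volume

theorem ket_coherentState (z : ℂ) : ket (coherentState z) = displacement z (ket vacuum) := by
  refine Lp.ext ?_
  have h1 := displacementQP_coeFn (Real.sqrt 2 * z.re) (Real.sqrt 2 * z.im) (ket vacuum)
  have h2 := (measurePreserving_sub_right (volume : Measure ℝ)
    (Real.sqrt 2 * z.re)).quasiMeasurePreserving.ae_eq (vacuum.coeFn_toLp 2 volume)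
  filter_upwards [h1, h2, (coherentState z).coeFn_toLp 2 volume] with x hx1 hx2 hx3
  simp only [Function.comp_apply] at hx2
  unfold ket displacement at *
  rw [hx1, hx2, hx3]
  have hs : ((Real.sqrt 2 : ℝ) : ℂ) ^ 2 = 2 := by
    rw [← Complex.ofReal_pow, Real.sq_sqrt (by norm_num)]; norm_num
  have hz : (‖z‖ : ℂ) ^ 2 = (z.re : ℂ) ^ 2 + (z.im : ℂ) ^ 2 := by
    rw [← Complex.ofReal_pow, Complex.sq_norm, Complex.normSq_apply]; push_cast; ring
  have hI : z ^ 2 = (z.re : ℂ) ^ 2 - (z.im : ℂ) ^ 2 + 2 * z.re * z.im * I := by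
    conv_lhs => rw [← Complex.re_add_im z]
    linear_combination (z.im : ℂ) ^ 2 * Complex.I_sq
  change _ * Complex.exp _ * Complex.exp _ = phase _ _ _ * (_ * Complex.exp _)
  unfold phase
  rw [mul_assoc, mul_left_comm (Complex.exp _), ← Complex.exp_add, ← Complex.exp_add]
  congr 2
  rw [hz, hI]
  push_cast
  conv_lhs => rw [show ((Real.sqrt 2 : ℝ) : ℂ) * z = Real.sqrt 2 * (z.re + z.im * I) by
    rw [Complex.re_add_im]]
  linear_combination (-(1 / 2 : ℂ) * (-(z.re : ℂ) ^ 2 - z.re * z.im * I)) * hs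

/-! ### Normal ordering -/

/-- `K = :F(a†, a):`. That is, `F(ζ, w) = ∑ f_{mn} ζ^m w^n` is an entire function in two commuting
variables (`ζ` stands for `a†`, `w` for `a`), and `K = ∑ f_{mn} (a†)^m a^n`, with all creation
operators to the left, where the sum converges in the sense of matrix elements
`⟨φ|(a†)^m a^n|ψ⟩ = ⟨a^m φ|a^n ψ⟩` between finite linear combinations of number states and coherent
states. -/
def IsNormalOrderedForm (K : H →L[ℂ] H) (F : ℂ → ℂ → ℂ) : Prop :=
  ∃ f : ℕ × ℕ → ℂ,
    (∀ ζ w : ℂ, HasSum (fun m : ℕ × ℕ => f m * ζ ^ m.1 * w ^ m.2) (F ζ w)) ∧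
    ∀ φ ∈ fockDomain, ∀ ψ ∈ fockDomain,
      HasSum (fun m : ℕ × ℕ =>
          f m * ⟪ket ((annihilation ^ m.1) φ), ket ((annihilation ^ m.2) ψ)⟫_ℂ)
        ⟪ket φ, K (ket ψ)⟫_ℂ

/-- The error function `erf z = (2/√π) ∫_0^z e^{-u²} du` on `ℂ`, the integral being taken along the
segment from `0` to `z`. -/
def erf (z : ℂ) : ℂ :=
  2 / (Real.sqrt Real.pi : ℂ) * ∫ r in (0 : ℝ)..1, z * Complex.exp (-((r : ℂ) * z) ^ 2)

end RegionOp

end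

namespace RegionOp

open scoped ComplexConjugate

/-! ### Entire double power series -/

/-- `F` is the sum of a double power series that converges absolutely on all of `ℂ × ℂ`. -/
def IsEntireDoubleSeries (F : ℂ → ℂ → ℂ) : Prop :=
  ∃ f : ℕ × ℕ → ℂ,
    ∀ ζ w : ℂ, HasSum (fun m : ℕ × ℕ => f m * ζ ^ m.1 * w ^ m.2) (F ζ w)

theorem IsEntireDoubleSeries.const_mul {F : ℂ → ℂ → ℂ} (hF : IsEntireDoubleSeries F) (z : ℂ) :
    IsEntireDoubleSeries fun ζ w => z * F ζ w := by
  obtain ⟨f, hf⟩ := hF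
  refine ⟨fun m => z * f m, fun ζ w => ?_⟩
  simpa only [mul_assoc] using (hf ζ w).mul_left z

theorem IsEntireDoubleSeries.mul {F G : ℂ → ℂ → ℂ} (hF : IsEntireDoubleSeries F)
    (hG : IsEntireDoubleSeries G) : IsEntireDoubleSeries fun ζ w => F ζ w * G ζ w := by
  obtain ⟨f, hf⟩ := hF
  obtain ⟨g, hg⟩ := hG
  have hprod : ∀ ζ w : ℂ, HasSum (fun x : (ℕ × ℕ) × (ℕ × ℕ) =>
      f x.1 * g x.2 * (ζ ^ (x.1 + x.2).1 * w ^ (x.1 + x.2).2)) (F ζ w * G ζ w) := by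
    intro ζ w
    have h1 := hf ζ w
    have h2 := hg ζ w
    set u : ℕ × ℕ → ℂ := fun m => f m * ζ ^ m.1 * w ^ m.2 with hu
    set v : ℕ × ℕ → ℂ := fun m => g m * ζ ^ m.1 * w ^ m.2 with hv
    have h : HasSum (fun x : (ℕ × ℕ) × (ℕ × ℕ) => u x.1 * v x.2) (F ζ w * G ζ w) :=
      h1.mul h2 (summable_mul_of_summable_norm h1.summable.norm h2.summable.norm)
    refine h.congr_fun fun x => ?_
    simp only [hu, hv, Prod.fst_add, Prod.snd_add, pow_add]
    ring
  let e := Equiv.sigmaFiberEquiv fun x : (ℕ × ℕ) × (ℕ × ℕ) => x.1 + x.2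
  have hfib : ∀ n : ℕ × ℕ, Summable fun x : {x : (ℕ × ℕ) × (ℕ × ℕ) // x.1 + x.2 = n} =>
      f x.1.1 * g x.1.2 := fun n => by
    have := (hprod 1 1).summable.subtype {x | x.1 + x.2 = n}
    simpa [Function.comp_def] using! this
  refine ⟨fun n => ∑' x : {x : (ℕ × ℕ) × (ℕ × ℕ) // x.1 + x.2 = n}, f x.1.1 * g x.1.2,
    fun ζ w => ?_⟩
  refine HasSum.sigma (e.hasSum_iff.2 (hprod ζ w)) fun n => ?_
  rw [mul_assoc]
  refine ((hfib n).hasSum.mul_right (ζ ^ n.1 * w ^ n.2)).congr_fun fun x => ?_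
  obtain ⟨x, rfl⟩ := x
  rfl

theorem IsEntireDoubleSeries.of_differentiable {h : ℂ → ℂ} (hh : Differentiable ℂ h) (α β : ℂ) :
    IsEntireDoubleSeries fun ζ w => h (α * ζ + β * w) := by
  set a : ℕ → ℂ := fun n => (n.factorial : ℂ)⁻¹ * iteratedDeriv n h 0 with ha
  have hsum : ∀ s : ℂ, HasSum (fun n => a n * s ^ n) (h s) := fun s => by
    refine (Complex.hasSum_taylorSeries_of_entire hh 0 s).congr_fun fun n => ?_
    simp only [ha, sub_zero, smul_eq_mul]
    ring
  refine ⟨fun m => a (m.1 + m.2) * ((m.1 + m.2).choose m.1) * α ^ m.1 * β ^ m.2,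
    fun ζ w => ?_⟩
  set T : ℕ × ℕ → ℂ := fun m =>
    a (m.1 + m.2) * ((m.1 + m.2).choose m.1) * α ^ m.1 * β ^ m.2 * ζ ^ m.1 * w ^ m.2
  have hT : ∀ n, ∀ m ∈ Finset.HasAntidiagonal.antidiagonal n,
      T m = a n * ((α * ζ) ^ m.1 * (β * w) ^ m.2 * n.choose m.1) := by
    intro n m hm
    rw [Finset.HasAntidiagonal.mem_antidiagonal] at hm
    simp only [T, hm, mul_pow]
    ring
  have hfin : ∀ n, HasSum (fun m : Finset.HasAntidiagonal.antidiagonal n => T m)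
      (a n * (α * ζ + β * w) ^ n) := by
    intro n
    rw [(Commute.all _ _).add_pow', Finset.mul_sum]
    have := Finset.hasSum (Finset.HasAntidiagonal.antidiagonal n) T
    rw [Finset.sum_congr rfl (hT n)] at this
    simpa [nsmul_eq_mul, mul_comm, Function.comp_def] using this
  have hs : Summable fun x : Σ n, Finset.HasAntidiagonal.antidiagonal n => T x.2.1 := by
    refine Summable.of_norm ?_
    rw [summable_sigma_of_nonneg fun _ => norm_nonneg _]
    refine ⟨fun n => Summable.of_finite, ?_⟩
    refine (hsum ((‖α * ζ‖ + ‖β * w‖ : ℝ) : ℂ)).summable.norm.congr fun n => ?_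
    rw [tsum_fintype, Finset.sum_coe_sort (Finset.HasAntidiagonal.antidiagonal n) (fun m => ‖T m‖),
      norm_mul, norm_pow, Complex.norm_real,
      Real.norm_of_nonneg (by positivity), (Commute.all _ _).add_pow', Finset.mul_sum]
    refine Finset.sum_congr rfl fun m hm => ?_
    rw [hT n m hm]
    simp [nsmul_eq_mul, mul_comm]
  exact Finset.HasAntidiagonal.sigmaAntidiagonalEquivProd.hasSum_iff.1
    (HasSum.sigma_of_hasSum (hsum _) hfin hs)

/-! ### The error function -/

theorem hasDerivAt_erf (z : ℂ) :
    HasDerivAt erf (2 / (Real.sqrt Real.pi : ℂ) * Complex.exp (-z ^ 2)) z := by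
  let F : ℂ → ℝ → ℂ := fun z r => z * Complex.exp (-((r : ℂ) * z) ^ 2)
  let F' : ℂ → ℝ → ℂ := fun z r =>
    Complex.exp (-((r : ℂ) * z) ^ 2) * (1 - 2 * (r : ℂ) ^ 2 * z ^ 2)
  have hF : ∀ r z, HasDerivAt (fun z => F z r) (F' z r) z := by
    intro r z
    have h := (hasDerivAt_id z).mul ((((hasDerivAt_id z).const_mul (r : ℂ)).pow 2).neg.cexp)
    refine h.congr_deriv ?_
    simp [F']
    ring
  have hcont : Continuous fun x : ℂ × ℝ => F' x.1 x.2 := by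
    simp only [F']
    fun_prop
  obtain ⟨C, hC⟩ := ((isCompact_closedBall z 1).prod (isCompact_Icc (a := (0:ℝ)) (b := 1)))
    |>.exists_bound_of_continuousOn hcont.continuousOn
  have key := intervalIntegral.hasDerivAt_integral_of_dominated_loc_of_deriv_le
    (F := F) (F' := F') (x₀ := z) (s := Metric.ball z 1) (bound := fun _ => C)
    (a := 0) (b := 1) (μ := volume) (Metric.ball_mem_nhds z one_pos)
    (Eventually.of_forall fun x => Continuous.aestronglyMeasurable (by simp only [F]; fun_prop))
    (Continuous.intervalIntegrable (by simp only [F]; fun_prop) _ _)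
    (Continuous.aestronglyMeasurable (by simp only [F']; fun_prop))
    (Eventually.of_forall fun r hr x hx => hC (x, r) ⟨Metric.ball_subset_closedBall hx, by
      rw [Set.uIoc_of_le zero_le_one] at hr; exact Set.Ioc_subset_Icc_self hr⟩)
    (by simp) (Eventually.of_forall fun r _ x _ => hF r x)
  have hint : ∫ r in (0 : ℝ)..1, F' z r = Complex.exp (-z ^ 2) := by
    have hr : ∀ r : ℝ, HasDerivAt (fun r : ℝ => (r : ℂ) * Complex.exp (-((r : ℂ) * z) ^ 2))
        (F' z r) r := by
      intro r
      have h := (hasDerivAt_id (r : ℂ)).mul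
        ((((hasDerivAt_id (r : ℂ)).mul_const z).pow 2).neg.cexp)
      refine (h.comp_ofReal).congr_deriv ?_
      simp [F']
      ring
    rw [intervalIntegral.integral_eq_sub_of_hasDerivAt (fun r _ => hr r)
      (Continuous.intervalIntegrable (by simp only [F']; fun_prop) _ _)]
    simp
  rw [← hint]
  exact key.2.const_mul _

theorem differentiable_erf : Differentiable ℂ erf := fun z => (hasDerivAt_erf z).differentiableAt

theorem setIntegral_Icc_gaussian_eq_erf (s : ℂ) {x₀ A : ℝ} (hA : 0 ≤ A) :
    ∫ q in Set.Icc x₀ (x₀ + A), Complex.exp (-(s + q) ^ 2) =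
      (Real.sqrt Real.pi : ℂ) / 2 * (erf (s + x₀ + A) - erf (s + x₀)) := by
  have hπ : (Real.sqrt Real.pi : ℂ) ≠ 0 := by
    exact_mod_cast (Real.sqrt_pos.2 Real.pi_pos).ne'
  rw [integral_Icc_eq_integral_Ioc, ← intervalIntegral.integral_of_le (by linarith)]
  have hr : ∀ r : ℝ, HasDerivAt (fun r : ℝ => (Real.sqrt Real.pi : ℂ) / 2 * erf (s + r))
      (Complex.exp (-(s + r) ^ 2)) r := by
    intro r
    have h := ((hasDerivAt_erf (s + r)).comp (r : ℂ)
      ((hasDerivAt_id (r : ℂ)).const_add s)).comp_ofReal.const_mul ((Real.sqrt Real.pi : ℂ) / 2)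
    refine h.congr_deriv ?_
    field_simp
  rw [intervalIntegral.integral_eq_sub_of_hasDerivAt (fun r _ => hr r)
      (Continuous.intervalIntegrable (by fun_prop) _ _)]
  push_cast
  rw [← mul_sub, add_assoc]

/-! ### Covariance of the Wigner operators and of the region operators -/

theorem displacementQP_comp_neg (q p : ℝ) (ψ : H) :
    displacementQP q p (displacementQP (-q) (-p) ψ) = ψ := by
  simpa using displacementQP_neg_comp (-q) (-p) ψ

theorem displacementQP_mem_unitary (q p : ℝ) : displacementQP q p ∈ unitary (H →L[ℂ] H) := by
  rw [Unitary.mem_iff, ContinuousLinearMap.star_eq_adjoint, adjoint_displacementQP]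
  exact ⟨ContinuousLinearMap.ext (displacementQP_neg_comp q p),
    ContinuousLinearMap.ext (displacementQP_comp_neg q p)⟩

theorem displacementQP_displacementQP (s t q p : ℝ) (ψ : H) :
    displacementQP s t (displacementQP q p ψ) =
      Complex.exp ((((t * q - s * p) / 2 : ℝ) : ℂ) * I) • displacementQP (s + q) (t + p) ψ := by
  refine Lp.ext ?_
  have h1 := displacementQP_coeFn s t (displacementQP q p ψ)
  have h2 := (measurePreserving_sub_right (volume : Measure ℝ) s).quasiMeasurePreserving.ae_eq
    (displacementQP_coeFn q p ψ)
  have h3 := displacementQP_coeFn (s + q) (t + p) ψ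
  have h4 := Lp.coeFn_smul (Complex.exp ((((t * q - s * p) / 2 : ℝ) : ℂ) * I))
    (displacementQP (s + q) (t + p) ψ)
  filter_upwards [h1, h2, h3, h4] with x hx1 hx2 hx3 hx4
  simp only [Function.comp_apply] at hx2
  rw [hx1, hx2, hx4, Pi.smul_apply, hx3, smul_eq_mul, ← mul_assoc, ← mul_assoc, sub_sub]
  congr 1
  unfold phase
  rw [← Complex.exp_add, ← Complex.exp_add]
  congr 1
  push_cast
  ring

theorem displacementQP_wignerOperator (c s t : ℝ) (y : ℝ × ℝ) (ψ : H) :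
    displacementQP s t (wignerOperator c y (displacementQP (-s) (-t) ψ)) =
      wignerOperator c (y.1 + s, y.2 + t) ψ := by
  simp only [wignerOperator_apply, map_smul, displacementQP_displacementQP, smul_smul]
  rw [mul_assoc, ← Complex.exp_add]
  have : (((-y.2 * -s - -y.1 * -t) / 2 : ℝ) : ℂ) * I + (((t * y.1 - s * y.2) / 2 : ℝ) : ℂ) * I
      = 0 := by
    push_cast; ring
  rw [this, Complex.exp_zero, mul_one, add_comm s, add_comm t, neg_add, neg_add]

theorem inner_parity (φ ψ : H) : ⟪φ, parity ψ⟫_ℂ = ⟪parity φ, ψ⟫_ℂ := by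
  have hp : ∀ χ : H, parity (parity χ) = χ := by
    intro χ
    refine Lp.ext ?_
    have h1 : (parity (parity χ) : ℝ → ℂ) =ᵐ[volume] parity χ ∘ (fun x : ℝ => -x) :=
      Lp.coeFn_compMeasurePreserving (parity χ) (Measure.measurePreserving_neg volume)
    have h2 := (Measure.measurePreserving_neg (volume : Measure ℝ)).quasiMeasurePreserving.ae_eq
      (Lp.coeFn_compMeasurePreserving χ (Measure.measurePreserving_neg volume))
    filter_upwards [h1, h2] with x hx1 hx2
    rw [hx1]
    refine hx2.trans ?_
    simp
  have h := (Lp.compMeasurePreservingₗᵢ ℂ (E := ℂ) (p := 2) (fun x : ℝ => -x)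
    (Measure.measurePreserving_neg volume)).inner_map_map (parity φ) ψ
  rw [← h]
  change _ = ⟪parity (parity φ), parity ψ⟫_ℂ
  rw [hp]

theorem inner_displacementQP (q p : ℝ) (φ ψ : H) :
    ⟪φ, displacementQP q p ψ⟫_ℂ = ⟪displacementQP (-q) (-p) φ, ψ⟫_ℂ := by
  rw [← adjoint_displacementQP, ContinuousLinearMap.adjoint_inner_left]

theorem inner_wignerOperator (c : ℝ) (y : ℝ × ℝ) (φ ψ : H) :
    ⟪φ, wignerOperator c y ψ⟫_ℂ = ⟪wignerOperator c y φ, ψ⟫_ℂ := by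
  simp only [wignerOperator_apply, inner_smul_left, inner_smul_right, inner_displacementQP,
    inner_parity, Complex.conj_ofReal, neg_neg]

theorem ofReal_wignerFunction (c : ℝ) (ψ : H) (y : ℝ × ℝ) :
    (wignerFunction c ψ y : ℂ) = ⟪ψ, wignerOperator c y ψ⟫_ℂ := by
  unfold wignerFunction
  refine Complex.conj_eq_iff_re.1 ?_
  rw [inner_conj_symm, inner_wignerOperator]

theorem regionOperator_apply (c : ℝ) {S : Set (ℝ × ℝ)} (hS : volume S ≠ ∞) (ψ : H) :
    regionOperator c S hS ψ = ∫ y in S, wignerOperator c y ψ := rfl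

theorem inner_regionOperator (c : ℝ) {S : Set (ℝ × ℝ)} (hS : volume S ≠ ∞) (φ ψ : H) :
    ⟪φ, regionOperator c S hS ψ⟫_ℂ = ∫ y in S, ⟪φ, wignerOperator c y ψ⟫_ℂ := by
  rw [regionOperator_apply]
  exact ((innerSL ℂ φ).integral_comp_comm (integrableOn_wignerOperator c hS ψ)).symm

theorem ofReal_quasiprobabilityVolume (c : ℝ) {S : Set (ℝ × ℝ)} (hS : volume S ≠ ∞) (ψ : H) :
    (quasiprobabilityVolume c S ψ : ℂ) = ⟪ψ, regionOperator c S hS ψ⟫_ℂ := by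
  rw [inner_regionOperator, quasiprobabilityVolume, ← integral_complex_ofReal]
  simp only [ofReal_wignerFunction]

theorem preimage_add_rectangle (x₀ k₀ A B s t : ℝ) :
    (fun y : ℝ × ℝ => y + (s, t)) ⁻¹' rectangle (x₀ + s) (k₀ + t) A B = rectangle x₀ k₀ A B := by
  ext ⟨q, p⟩
  simp only [rectangle, Set.mem_preimage, Set.mem_prod, Set.mem_Icc, Prod.fst_add, Prod.snd_add]
  constructor <;> rintro ⟨⟨_, _⟩, _, _⟩ <;> refine ⟨⟨?_, ?_⟩, ?_, ?_⟩ <;> linarith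

theorem displacementQP_rectangleOperator (c x₀ k₀ A B s t : ℝ) (ψ : H) :
    displacementQP s t (rectangleOperator c x₀ k₀ A B (displacementQP (-s) (-t) ψ)) =
      rectangleOperator c (x₀ + s) (k₀ + t) A B ψ := by
  unfold rectangleOperator
  rw [regionOperator_apply, regionOperator_apply, ← ContinuousLinearMap.integral_comp_comm _
    (integrableOn_wignerOperator c (volume_rectangle_ne_top x₀ k₀ A B) _)]
  simp only [displacementQP_wignerOperator]
  rw [← preimage_add_rectangle x₀ k₀ A B s t]
  exact (measurePreserving_add_right volume ((s, t) : ℝ × ℝ)).setIntegral_preimage_emb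
    (measurableEmbedding_addRight _) (fun y => wignerOperator c y ψ) _

theorem eigenspace_of_conj {V : Type*} [AddCommGroup V] [Module ℂ V] {D D' K L : V →ₗ[ℂ] V}
    (h1 : ∀ v, D' (D v) = v) (h2 : ∀ v, D (D' v) = v) (hL : ∀ v, D (K (D' v)) = L v) (μ : ℂ) :
    Module.End.eigenspace L μ = (Module.End.eigenspace K μ).map D := by
  ext v
  simp only [Submodule.mem_map, Module.End.mem_eigenspace_iff]
  constructor
  · intro hv
    refine ⟨D' v, ?_, h2 v⟩
    rw [← h1 (K (D' v)), hL, hv, map_smul]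
  · rintro ⟨u, hu, rfl⟩
    rw [← hL, h1, hu, map_smul]

theorem quasiprobabilityVolume_displacementQP (c x₀ k₀ A B s t : ℝ) (ψ : H) :
    quasiprobabilityVolume c (rectangle (x₀ + s) (k₀ + t) A B) (displacementQP s t ψ) =
      quasiprobabilityVolume c (rectangle x₀ k₀ A B) ψ := by
  apply Complex.ofReal_injective
  rw [ofReal_quasiprobabilityVolume c (volume_rectangle_ne_top _ _ _ _),
    ofReal_quasiprobabilityVolume c (volume_rectangle_ne_top _ _ _ _)]
  change ⟪_, rectangleOperator c _ _ A B _⟫_ℂ = ⟪_, rectangleOperator c _ _ A B _⟫_ℂ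
  rw [← displacementQP_rectangleOperator, inner_displacementQP, displacementQP_neg_comp]

/-! ### The ladder operators -/

theorem ket_add (φ ψ : 𝓢(ℝ, ℂ)) : ket (φ + ψ) = ket φ + ket ψ :=
  map_add (SchwartzMap.toLpCLM ℂ ℂ 2 volume) φ ψ

theorem ket_smul (z : ℂ) (φ : 𝓢(ℝ, ℂ)) : ket (z • φ) = z • ket φ :=
  map_smul (SchwartzMap.toLpCLM ℂ ℂ 2 volume) z φ

theorem ket_zero : ket 0 = 0 :=
  map_zero (SchwartzMap.toLpCLM ℂ ℂ 2 volume)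

theorem inner_ket (φ ψ : 𝓢(ℝ, ℂ)) : ⟪ket φ, ket ψ⟫_ℂ = ∫ x, conj (φ x) * ψ x := by
  rw [L2.inner_def]
  refine integral_congr_ae ?_
  filter_upwards [φ.coeFn_toLp 2 volume, ψ.coeFn_toLp 2 volume] with x h1 h2
  unfold ket
  rw [h1, h2, RCLike.inner_apply, mul_comm]

theorem position_apply (φ : 𝓢(ℝ, ℂ)) (x : ℝ) : position φ x = x * φ x := by
  simp only [position, ContinuousLinearMap.coe_coe]
  rw [SchwartzMap.smulLeftCLM_apply_apply (by fun_prop), smul_eq_mul]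

theorem annihilation_eq (φ : 𝓢(ℝ, ℂ)) : annihilation φ =
    ((Real.sqrt 2 : ℂ)⁻¹) • (position φ + SchwartzMap.derivCLM ℂ ℂ φ) := by
  simp [annihilation, momentum, smul_smul]

theorem creation_eq (φ : 𝓢(ℝ, ℂ)) : creation φ =
    ((Real.sqrt 2 : ℂ)⁻¹) • (position φ - SchwartzMap.derivCLM ℂ ℂ φ) := by
  simp [creation, momentum, smul_smul]

theorem derivCLM_position (φ : 𝓢(ℝ, ℂ)) : SchwartzMap.derivCLM ℂ ℂ (position φ) =
    φ + position (SchwartzMap.derivCLM ℂ ℂ φ) := by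
  ext x
  have h : HasDerivAt (fun x : ℝ => (x : ℂ) * φ x) (1 * φ x + x * deriv φ x) x :=
    (hasDerivAt_id (x : ℂ)).comp_ofReal.mul φ.differentiableAt.hasDerivAt
  have hp : (position φ : ℝ → ℂ) = fun x : ℝ => (x : ℂ) * φ x := funext (position_apply φ)
  rw [SchwartzMap.derivCLM_apply, hp, h.deriv, _root_.add_apply, position_apply,
    SchwartzMap.derivCLM_apply, one_mul]

theorem ofReal_sqrt_two_sq : (Real.sqrt 2 : ℂ) ^ 2 = 2 := by
  rw [← Complex.ofReal_pow, Real.sq_sqrt (by norm_num)]; norm_num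

theorem ofReal_sqrt_two_ne_zero : (Real.sqrt 2 : ℂ) ≠ 0 := by
  intro h
  simpa [h] using ofReal_sqrt_two_sq

/-- The canonical commutation relation. -/
theorem annihilation_creation (φ : 𝓢(ℝ, ℂ)) :
    annihilation (creation φ) = creation (annihilation φ) + φ := by
  have h : (Real.sqrt 2 : ℂ)⁻¹ * (Real.sqrt 2 : ℂ)⁻¹ = 1 / 2 := by
    rw [← mul_inv, ← sq, ofReal_sqrt_two_sq, one_div]
  simp only [annihilation_eq, creation_eq, map_smul, map_add, map_sub, derivCLM_position,
    smul_add, smul_sub, smul_smul, h]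
  module

theorem inner_creation (φ ψ : 𝓢(ℝ, ℂ)) :
    ⟪ket (creation φ), ket ψ⟫_ℂ = ⟪ket φ, ket (annihilation ψ)⟫_ℂ := by
  have hpos : ⟪ket (position φ), ket ψ⟫_ℂ = ⟪ket φ, ket (position ψ)⟫_ℂ := by
    simp only [inner_ket, position_apply, map_mul, Complex.conj_ofReal]
    congr 1 with x
    ring
  have hder : ⟪ket (SchwartzMap.derivCLM ℂ ℂ φ), ket ψ⟫_ℂ =
      -⟪ket φ, ket (SchwartzMap.derivCLM ℂ ℂ ψ)⟫_ℂ := by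
    have h := SchwartzMap.integral_bilinear_deriv_right_eq_neg_left φ ψ
      ((ContinuousLinearMap.mul ℝ ℂ).comp (conjCLE : ℂ →L[ℝ] ℂ))
    simp only [inner_ket, SchwartzMap.derivCLM_apply]
    rw [eq_neg_iff_add_eq_zero, add_comm, ← eq_neg_iff_add_eq_zero]
    simpa using h
  have e : ∀ f g : 𝓢(ℝ, ℂ), f - g = f + (-1 : ℂ) • g := fun f g => by module
  rw [annihilation_eq, creation_eq, e]
  simp only [ket_smul, ket_add, inner_smul_left, inner_smul_right, inner_add_left,
    inner_add_right, hpos, hder, map_inv₀, Complex.conj_ofReal, map_neg, map_one]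
  ring

/-! ### Exponential vectors -/

/-- The exponential vector `e^{z a†}|0⟩ = e^{|z|²/2}|z⟩`, with wave function
`π^{-1/4} e^{-x²/2 + √2 z x - z²/2}`. -/
noncomputable def expState (z : ℂ) : 𝓢(ℝ, ℂ) :=
  (((Real.pi ^ (-(1 / 4) : ℝ) : ℝ) : ℂ) * Complex.exp (-(z ^ 2) / 2)) •
    gaussian (Real.sqrt 2 * z)

theorem expState_apply (z : ℂ) (x : ℝ) : expState z x = ((Real.pi ^ (-(1 / 4) : ℝ) : ℝ) : ℂ) *
    Complex.exp (-(z ^ 2) / 2 + (-(1 / 2) * (x : ℂ) ^ 2 + Real.sqrt 2 * z * x)) := by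
  rw [Complex.exp_add, ← mul_assoc]
  rfl

theorem coherentState_eq (z : ℂ) :
    coherentState z = Complex.exp (-(‖z‖ : ℂ) ^ 2 / 2) • expState z := by
  rw [coherentState, expState, smul_smul]
  congr 1
  rw [mul_left_comm, ← Complex.exp_add]
  congr 2
  ring

theorem vacuum_eq : vacuum = expState 0 := by
  simp [vacuum, expState]

theorem annihilation_expState (z : ℂ) : annihilation (expState z) = z • expState z := by
  ext x
  have h : HasDerivAt (fun x : ℂ => Complex.exp (-(z ^ 2) / 2 +
      (-(1 / 2) * x ^ 2 + Real.sqrt 2 * z * x))) (Complex.exp (-(z ^ 2) / 2 +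
      (-(1 / 2) * (x : ℂ) ^ 2 + Real.sqrt 2 * z * x)) * (-x + Real.sqrt 2 * z)) x := by
    refine (((((hasDerivAt_id (x : ℂ)).pow 2).const_mul _).add
      ((hasDerivAt_id (x : ℂ)).const_mul _)).const_add _).cexp.congr_deriv ?_
    simp
  have h' := (h.const_mul ((Real.pi ^ (-(1 / 4) : ℝ) : ℝ) : ℂ)).comp_ofReal
  have hf : (expState z : ℝ → ℂ) = _ := funext (expState_apply z)
  rw [annihilation_eq, _root_.smul_apply, _root_.add_apply, _root_.smul_apply,
    position_apply, SchwartzMap.derivCLM_apply, hf, h'.deriv, smul_eq_mul, smul_eq_mul]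
  have := ofReal_sqrt_two_ne_zero
  field_simp
  ring

theorem annihilation_pow_expState (z : ℂ) (n : ℕ) :
    (annihilation ^ n) (expState z) = z ^ n • expState z := by
  induction n with
  | zero => simp
  | succ n ih =>
    rw [pow_succ, Module.End.mul_apply, annihilation_expState, map_smul, ih, smul_smul,
      pow_succ']

theorem annihilation_vacuum : annihilation vacuum = 0 := by
  rw [vacuum_eq, annihilation_expState, zero_smul]

theorem inner_expState (u z : ℂ) :
    ⟪ket (expState u), ket (expState z)⟫_ℂ = Complex.exp (conj u * z) := by
  have hπ : (((Real.pi ^ (-(1 / 4) : ℝ) : ℝ) : ℂ) * ((Real.pi ^ (-(1 / 4) : ℝ) : ℝ) : ℂ)) *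
      ((Real.pi : ℂ) / -(-1 : ℂ)) ^ (1 / 2 : ℂ) = 1 := by
    rw [neg_neg, div_one, show (1 / 2 : ℂ) = ((1 / 2 : ℝ) : ℂ) by norm_num,
      ← Complex.ofReal_cpow Real.pi_pos.le, ← Complex.ofReal_mul, ← Complex.ofReal_mul,
      ← Real.rpow_add Real.pi_pos, ← Real.rpow_add Real.pi_pos]
    norm_num
  have hint := integral_cexp_quadratic (b := -1) (by simp)
    (Real.sqrt 2 * (conj u + z)) (-(conj u ^ 2) / 2 - z ^ 2 / 2)
  rw [inner_ket]
  have : ∀ x : ℝ, conj (expState u x) * expState z x =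
      (((Real.pi ^ (-(1 / 4) : ℝ) : ℝ) : ℂ) * ((Real.pi ^ (-(1 / 4) : ℝ) : ℝ) : ℂ)) *
      Complex.exp (-1 * (x : ℂ) ^ 2 + Real.sqrt 2 * (conj u + z) * x +
        (-(conj u ^ 2) / 2 - z ^ 2 / 2)) := by
    intro x
    rw [expState_apply, expState_apply, map_mul, Complex.conj_ofReal, ← Complex.exp_conj,
      mul_mul_mul_comm, ← Complex.exp_add]
    congr 2
    simp only [map_add, map_mul, map_neg, map_div₀, map_pow, Complex.conj_ofReal, map_one,
      map_ofNat]
    ring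
  simp only [this]
  rw [integral_const_mul, hint, ← mul_assoc, hπ, one_mul]
  congr 1
  linear_combination ((conj u + z) ^ 2 / 4) * ofReal_sqrt_two_sq

theorem displacementQP_expState (q p : ℝ) (z : ℂ) :
    displacementQP q p (ket (expState z)) =
      Complex.exp (-((q : ℂ) ^ 2 + (p : ℂ) ^ 2) / 4 - (q - p * I) / Real.sqrt 2 * z) •
        ket (expState (z + (q + p * I) / Real.sqrt 2)) := by
  rw [← ket_smul]
  refine Lp.ext ?_
  have h1 := displacementQP_coeFn q p (ket (expState z))
  have h2 := (measurePreserving_sub_right (volume : Measure ℝ)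
    q).quasiMeasurePreserving.ae_eq ((expState z).coeFn_toLp 2 volume)
  filter_upwards [h1, h2, SchwartzMap.coeFn_toLp (Complex.exp (-((q : ℂ) ^ 2 + (p : ℂ) ^ 2) / 4 -
    (q - p * I) / Real.sqrt 2 * z) • expState (z + (q + p * I) / Real.sqrt 2)) 2 volume]
    with x hx1 hx2 hx3
  simp only [Function.comp_apply] at hx2
  unfold ket at *
  rw [hx1, hx2, hx3, _root_.smul_apply, expState_apply, expState_apply, smul_eq_mul]
  unfold phase
  rw [mul_left_comm, mul_left_comm (Complex.exp _), ← Complex.exp_add, ← Complex.exp_add]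
  congr 2
  obtain ⟨r, hr, hr2⟩ : ∃ r : ℂ, (Real.sqrt 2 : ℂ)⁻¹ = r ∧ Real.sqrt 2 * r = 1 :=
    ⟨_, rfl, mul_inv_cancel₀ ofReal_sqrt_two_ne_zero⟩
  have hs := ofReal_sqrt_two_sq
  have hr3 : (Real.sqrt 2 : ℂ) = 2 * r := by
    linear_combination (-(Real.sqrt 2 : ℂ)) * hr2 + r * hs
  have hr4 : r ^ 2 = 1 / 2 := by
    linear_combination (1 / 2 : ℂ) * hr2 - (r / 2) * hr3
  simp only [div_eq_mul_inv, hr]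
  rw [hr3]
  push_cast
  linear_combination (-2 * p * x * I + p * q * I + (p : ℂ) ^ 2 * I ^ 2 / 2 - 2 * x * q +
    (q : ℂ) ^ 2 / 2) * hr4 + (p : ℂ) ^ 2 / 4 * Complex.I_sq

/-! ### Matrix elements of the rectangle operator between exponential vectors -/

theorem parity_expState (z : ℂ) : parity (ket (expState z)) = ket (expState (-z)) := by
  refine Lp.ext ?_
  have h1 : (parity (ket (expState z)) : ℝ → ℂ) =ᵐ[volume]
      ket (expState z) ∘ (fun x : ℝ => -x) :=
    Lp.coeFn_compMeasurePreserving _ (Measure.measurePreserving_neg volume)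
  have h2 := (Measure.measurePreserving_neg (volume : Measure ℝ)).quasiMeasurePreserving.ae_eq
    ((expState z).coeFn_toLp 2 volume)
  filter_upwards [h1, h2, (expState (-z)).coeFn_toLp 2 volume] with x hx1 hx2 hx3
  simp only [Function.comp_apply] at hx1 hx2
  unfold ket at *
  rw [hx1, hx2, hx3, expState_apply, expState_apply]
  push_cast
  ring_nf

theorem inner_wignerOperator_expState (c : ℝ) (y : ℝ × ℝ) (u z : ℂ) :
    ⟪ket (expState u), wignerOperator c y (ket (expState z))⟫_ℂ =
      c * Complex.exp (conj u * z) *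
        (Complex.exp (-(-(1 / (Real.sqrt 2 : ℂ)) * (conj u + z) + y.1) ^ 2) *
          Complex.exp (-(-(I / (Real.sqrt 2 : ℂ)) * (conj u - z) + y.2) ^ 2)) := by
  simp only [wignerOperator_apply, displacementQP_expState, map_smul, parity_expState,
    inner_smul_right, inner_expState]
  rw [mul_assoc (c : ℂ), ← Complex.exp_add, ← Complex.exp_add, ← Complex.exp_add,
    ← Complex.exp_add]
  congr 2
  obtain ⟨r, hr⟩ : ∃ r : ℂ, (Real.sqrt 2 : ℂ)⁻¹ = r := ⟨_, rfl⟩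
  have hr4 : r ^ 2 = 1 / 2 := by
    rw [← hr, inv_pow, ofReal_sqrt_two_sq, one_div]
  simp only [div_eq_mul_inv, hr]
  push_cast
  linear_combination (-(y.1 : ℂ) ^ 2 + (y.2 : ℂ) ^ 2 * I ^ 2 - 2 * I ^ 2 * z * conj u +
    I ^ 2 * z ^ 2 + I ^ 2 * conj u ^ 2 + 2 * z * conj u + z ^ 2 + conj u ^ 2) * hr4 +
    ((y.2 : ℂ) ^ 2 / 2 - z * conj u + z ^ 2 / 2 + conj u ^ 2 / 2) * Complex.I_sq

theorem inner_rectangleOperator_expState (c x₀ k₀ : ℝ) {A B : ℝ} (hA : 0 ≤ A) (hB : 0 ≤ B)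
    (u z : ℂ) :
    ⟪ket (expState u), rectangleOperator c x₀ k₀ A B (ket (expState z))⟫_ℂ =
      ((c * Real.pi / 4 : ℝ) : ℂ) *
          (erf (-(1 / (Real.sqrt 2 : ℂ)) * (conj u + z) + x₀ + A) -
            erf (-(1 / (Real.sqrt 2 : ℂ)) * (conj u + z) + x₀)) *
          (erf (-(I / (Real.sqrt 2 : ℂ)) * (conj u - z) + k₀ + B) -
            erf (-(I / (Real.sqrt 2 : ℂ)) * (conj u - z) + k₀)) *
        Complex.exp (conj u * z) := by
  unfold rectangleOperator
  rw [inner_regionOperator]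
  simp only [inner_wignerOperator_expState]
  rw [integral_const_mul, rectangle, Measure.volume_eq_prod,
    setIntegral_prod_mul
      (fun q : ℝ => Complex.exp (-(-(1 / (Real.sqrt 2 : ℂ)) * (conj u + z) + q) ^ 2))
      (fun p : ℝ => Complex.exp (-(-(I / (Real.sqrt 2 : ℂ)) * (conj u - z) + p) ^ 2)),
    setIntegral_Icc_gaussian_eq_erf _ hA, setIntegral_Icc_gaussian_eq_erf _ hB]
  have hπ : (Real.sqrt Real.pi : ℂ) ^ 2 = Real.pi := by
    rw [← Complex.ofReal_pow, Real.sq_sqrt Real.pi_pos.le]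
  push_cast
  rw [← hπ]
  ring

theorem isEntireDoubleSeries_rectangle (c x₀ k₀ A B : ℝ) :
    IsEntireDoubleSeries fun ζ w => ((c * Real.pi / 4 : ℝ) : ℂ) *
          (erf (-(1 / (Real.sqrt 2 : ℂ)) * (ζ + w) + x₀ + A) -
            erf (-(1 / (Real.sqrt 2 : ℂ)) * (ζ + w) + x₀)) *
          (erf (-(I / (Real.sqrt 2 : ℂ)) * (ζ - w) + k₀ + B) -
            erf (-(I / (Real.sqrt 2 : ℂ)) * (ζ - w) + k₀)) := by
  have hd : ∀ x₀ A : ℝ, Differentiable ℂ fun s : ℂ => erf (s + x₀ + A) - erf (s + x₀) :=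
    fun x₀ A => (differentiable_erf.comp (by fun_prop)).sub (differentiable_erf.comp (by fun_prop))
  have h1 := IsEntireDoubleSeries.of_differentiable (hd x₀ A) (-(1 / (Real.sqrt 2 : ℂ)))
    (-(1 / (Real.sqrt 2 : ℂ)))
  have h2 := IsEntireDoubleSeries.of_differentiable (hd k₀ B) (-(I / (Real.sqrt 2 : ℂ)))
    (I / (Real.sqrt 2 : ℂ))
  convert! (h1.const_mul ((c * Real.pi / 4 : ℝ) : ℂ)).mul h2 using 7
  all_goals ring

/-! ### Number states as Taylor coefficients of the exponential vectors -/

/-- The Taylor coefficient `(a†)ᵏ|0⟩ / k!` of the exponential vectors. -/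
noncomputable def taylorState (k : ℕ) : 𝓢(ℝ, ℂ) := ((k.factorial : ℂ)⁻¹) • (creation ^ k) vacuum

theorem numberState_eq (k : ℕ) :
    numberState k = (k.factorial / Real.sqrt k.factorial : ℂ) • taylorState k := by
  rw [numberState, taylorState, smul_smul]
  congr 1
  have : (k.factorial : ℂ) ≠ 0 := by exact_mod_cast k.factorial_ne_zero
  field_simp

theorem annihilation_creation_pow_vacuum (k : ℕ) :
    annihilation ((creation ^ (k + 1)) vacuum) = ((k : ℂ) + 1) • (creation ^ k) vacuum := by
  induction k with
  | zero => simp [annihilation_creation, annihilation_vacuum]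
  | succ k ih =>
    rw [pow_succ', Module.End.mul_apply, annihilation_creation, ih, map_smul,
      ← Module.End.mul_apply, ← pow_succ']
    push_cast
    module

theorem annihilation_taylorState_zero : annihilation (taylorState 0) = 0 := by
  simp [taylorState, annihilation_vacuum]

theorem annihilation_taylorState_succ (k : ℕ) :
    annihilation (taylorState (k + 1)) = taylorState k := by
  rw [taylorState, map_smul, annihilation_creation_pow_vacuum, smul_smul, taylorState]
  congr 1
  have h : (k.factorial : ℂ) ≠ 0 := by exact_mod_cast k.factorial_ne_zero
  have h' : (k : ℂ) + 1 ≠ 0 := by exact_mod_cast k.succ_ne_zero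
  rw [Nat.factorial_succ]
  push_cast
  field_simp

theorem annihilation_pow_taylorState_add (n l : ℕ) :
    (annihilation ^ n) (taylorState (l + n)) = taylorState l := by
  induction n with
  | zero => rfl
  | succ n ih =>
    rw [pow_succ, Module.End.mul_apply, ← add_assoc, annihilation_taylorState_succ, ih]

theorem annihilation_pow_taylorState_of_lt {n k : ℕ} (h : k < n) :
    (annihilation ^ n) (taylorState k) = 0 := by
  obtain ⟨d, rfl⟩ := Nat.exists_eq_add_of_lt h
  have := annihilation_pow_taylorState_add k 0
  rw [zero_add] at this
  rw [show k + d + 1 = d + 1 + k by ring, pow_add, Module.End.mul_apply, this, pow_succ,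
    Module.End.mul_apply, annihilation_taylorState_zero, map_zero]

theorem inner_creation_pow (φ ψ : 𝓢(ℝ, ℂ)) (n : ℕ) :
    ⟪ket ((creation ^ n) φ), ket ψ⟫_ℂ = ⟪ket φ, ket ((annihilation ^ n) ψ)⟫_ℂ := by
  induction n generalizing ψ with
  | zero => rfl
  | succ n ih =>
    rw [pow_succ', Module.End.mul_apply, inner_creation, ih, pow_succ, Module.End.mul_apply]

theorem inner_taylorState_zero (k : ℕ) :
    ⟪ket (taylorState 0), ket (taylorState k)⟫_ℂ = if k = 0 then 1 else 0 := by
  have h0 : taylorState 0 = expState 0 := by simp [taylorState, vacuum_eq]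
  rcases k with - | k
  · rw [h0, inner_expState]; simp
  · have h : taylorState (k + 1) =
        ((k + 1).factorial : ℂ)⁻¹ • creation ((creation ^ k) vacuum) := by
      rw [taylorState, pow_succ', Module.End.mul_apply]
    rw [h, ket_smul, inner_smul_right, ← inner_conj_symm, inner_creation,
      annihilation_taylorState_zero, ket_zero]
    simp

theorem inner_taylorState (j k : ℕ) :
    ⟪ket (taylorState j), ket (taylorState k)⟫_ℂ = if j = k then (j.factorial : ℂ)⁻¹ else 0 := by
  have h0 : taylorState 0 = vacuum := by simp [taylorState]
  rw [taylorState, ket_smul, inner_smul_left, inner_creation_pow, ← h0]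
  rcases lt_or_ge k j with h | h
  · rw [annihilation_pow_taylorState_of_lt h, ket_zero, if_neg h.ne']
    simp
  · obtain ⟨l, rfl⟩ := Nat.exists_eq_add_of_le' h
    rw [annihilation_pow_taylorState_add, inner_taylorState_zero]
    rcases l with - | l <;> simp

theorem inner_taylorState_expState (k : ℕ) (z : ℂ) :
    ⟪ket (taylorState k), ket (expState z)⟫_ℂ = (k.factorial : ℂ)⁻¹ * z ^ k := by
  rw [taylorState, ket_smul, inner_smul_left, inner_creation_pow, annihilation_pow_expState,
    ket_smul, inner_smul_right, vacuum_eq, inner_expState]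
  simp

theorem norm_taylorState_sq (k : ℕ) : ‖ket (taylorState k)‖ ^ 2 = (k.factorial : ℝ)⁻¹ := by
  have h := inner_self_eq_norm_sq_to_K (𝕜 := ℂ) (ket (taylorState k))
  rw [inner_taylorState, if_pos rfl] at h
  exact Complex.ofReal_injective (by push_cast; exact h.symm)

theorem norm_taylorState (k : ℕ) : ‖ket (taylorState k)‖ = (Real.sqrt k.factorial)⁻¹ := by
  rw [← Real.sqrt_inv, ← norm_taylorState_sq, Real.sqrt_sq (norm_nonneg _)]

theorem norm_taylorState_le_one (k : ℕ) : ‖ket (taylorState k)‖ ≤ 1 := by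
  rw [norm_taylorState]
  exact inv_le_one_of_one_le₀ (Real.one_le_sqrt.2 (by exact_mod_cast k.factorial_pos))

theorem summable_norm_taylorState (r : ℝ) :
    Summable fun k : ℕ => r ^ k * ‖ket (taylorState k)‖ := by
  rcases eq_or_ne r 0 with rfl | hr
  · exact summable_of_ne_finset_zero (s := {0}) fun k hk => by
      rw [zero_pow (by simpa using hk), zero_mul]
  refine summable_of_ratio_test_tendsto_lt_one (l := 0) one_pos
    (Eventually.of_forall fun k => ?_) ?_
  · rw [norm_taylorState]; positivity
  · have h : ∀ k : ℕ, ‖r ^ (k + 1) * ‖ket (taylorState (k + 1))‖‖ /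
        ‖r ^ k * ‖ket (taylorState k)‖‖ = |r| * (Real.sqrt ((k : ℝ) + 1))⁻¹ := by
      intro k
      have h1 : Real.sqrt k.factorial ≠ 0 := by positivity
      have h2 : Real.sqrt ((k : ℝ) + 1) ≠ 0 := by positivity
      have h3 : |r| ≠ 0 := abs_ne_zero.2 hr
      rw [norm_taylorState, norm_taylorState, Nat.factorial_succ]
      push_cast
      rw [Real.sqrt_mul (by positivity)]
      simp only [norm_mul, norm_pow, norm_inv, Real.norm_eq_abs, abs_of_nonneg (Real.sqrt_nonneg _)]
      field_simp
      ring
    simp only [h]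
    have ht : Tendsto (fun k : ℕ => Real.sqrt ((k : ℝ) + 1)) atTop atTop :=
      Real.tendsto_sqrt_atTop.comp (tendsto_natCast_atTop_atTop.atTop_add tendsto_const_nhds)
    simpa using ht.inv_tendsto_atTop.const_mul |r|

theorem hasSum_taylorState (z : ℂ) :
    HasSum (fun k : ℕ => z ^ k • ket (taylorState k)) (ket (expState z)) := by
  have hs : Summable fun k : ℕ => z ^ k • ket (taylorState k) := by
    refine Summable.of_norm ((summable_norm_taylorState ‖z‖).congr fun k => ?_)
    rw [norm_smul, norm_pow]
  obtain ⟨X, hX⟩ := hs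
  have hexp : ∀ w : ℂ, HasSum (fun k : ℕ => (k.factorial : ℂ)⁻¹ * w ^ k) (Complex.exp w) := by
    intro w
    have := NormedSpace.expSeries_div_hasSum_exp (𝔸 := ℂ) w
    rw [← Complex.exp_eq_exp_ℂ] at this
    exact this.congr_fun fun k => by ring
  have h1 : ∀ k, ⟪ket (taylorState k), X⟫_ℂ = (k.factorial : ℂ)⁻¹ * z ^ k := by
    intro k
    have h := (innerSL ℂ (ket (taylorState k))).hasSum hX
    refine h.unique ?_
    convert! hasSum_ite_eq k ((k.factorial : ℂ)⁻¹ * z ^ k) using 2 with j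
    simp only [innerSL_apply_apply, inner_smul_right, inner_taylorState]
    rcases eq_or_ne j k with rfl | hjk
    · simp [mul_comm]
    · simp [hjk, hjk.symm]
  have h2 : ∀ Y : H, (∀ k, ⟪ket (taylorState k), Y⟫_ℂ = (k.factorial : ℂ)⁻¹ * z ^ k) →
      ⟪Y, X⟫_ℂ = Complex.exp (conj z * z) := by
    intro Y hY
    refine ((innerSL ℂ Y).hasSum hX).unique ((hexp (conj z * z)).congr_fun fun k => ?_)
    rw [innerSL_apply_apply, inner_smul_right, ← inner_conj_symm, hY]
    simp only [map_mul, map_inv₀, map_pow, Complex.conj_natCast]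
    ring
  have h3 := h2 X h1
  have h4 := h2 (ket (expState z)) fun k => inner_taylorState_expState k z
  have h5 : ⟪X, ket (expState z)⟫_ℂ = Complex.exp (conj z * z) := by
    rw [← inner_conj_symm, h4, ← Complex.exp_conj]
    simp [mul_comm]
  have h6 : ⟪X - ket (expState z), X - ket (expState z)⟫_ℂ = 0 := by
    rw [inner_sub_left, inner_sub_right, inner_sub_right, h3, h4, h5, inner_expState]
    ring
  rwa [← sub_eq_zero.1 (inner_self_eq_zero.1 h6)]

theorem hasSum_annihilation_pow_taylorState (n : ℕ) (z : ℂ) :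
    HasSum (fun k : ℕ => z ^ k • ket ((annihilation ^ n) (taylorState k)))
      (ket ((annihilation ^ n) (expState z))) := by
  rw [annihilation_pow_expState, ket_smul, ← hasSum_nat_add_iff' n, Finset.sum_eq_zero, sub_zero]
  · refine ((hasSum_taylorState z).const_smul (z ^ n)).congr_fun fun k => ?_
    rw [annihilation_pow_taylorState_add, smul_smul, pow_add, mul_comm]
  · intro k hk
    rw [annihilation_pow_taylorState_of_lt (Finset.mem_range.1 hk), ket_zero, smul_zero]

theorem hasSum_norm_annihilation_pow_taylorState (n : ℕ) :
    HasSum (fun k : ℕ => ‖ket ((annihilation ^ n) (taylorState k))‖)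
      (∑' k : ℕ, ‖ket (taylorState k)‖) := by
  rw [← hasSum_nat_add_iff' n, Finset.sum_eq_zero, sub_zero]
  · simp only [annihilation_pow_taylorState_add]
    exact (by simpa using summable_norm_taylorState 1 : Summable _).hasSum
  · intro k hk
    rw [annihilation_pow_taylorState_of_lt (Finset.mem_range.1 hk), ket_zero, norm_zero]

/-! ### From exponential vectors to number states -/

theorem eq_of_hasSum_pow {a b : ℕ → ℂ} {g : ℂ → ℂ}
    (ha : ∀ z : ℂ, ‖z‖ < 1 → HasSum (fun n => z ^ n * a n) (g z))
    (hb : ∀ z : ℂ, ‖z‖ < 1 → HasSum (fun n => z ^ n * b n) (g z)) : a = b := by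
  have key : ∀ c : ℕ → ℂ, (∀ z : ℂ, ‖z‖ < 1 → HasSum (fun n => z ^ n * c n) (g z)) →
      HasFPowerSeriesAt g (FormalMultilinearSeries.ofScalars ℂ c) 0 := by
    intro c hc
    rw [hasFPowerSeriesAt_iff]
    filter_upwards [Metric.ball_mem_nhds (0 : ℂ) one_pos] with z hz
    rw [zero_add]
    refine (hc z (by simpa using hz)).congr_fun fun n => ?_
    simp [FormalMultilinearSeries.coeff_ofScalars]
  have h := (key a ha).eq_formalMultilinearSeries (key b hb)
  funext n
  have := congrArg (fun p => FormalMultilinearSeries.coeff p n) h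
  simpa [FormalMultilinearSeries.coeff_ofScalars] using this

theorem summable_prod_of_norm_le {ι κ : Type*} {t : ι → κ → ℂ} {a : ι → ℝ} {b : ι → κ → ℝ} {S : ℝ}
    (ha : Summable a) (hb : ∀ i, HasSum (b i) S) (h : ∀ i k, ‖t i k‖ ≤ a i * b i k) :
    Summable fun x : ι × κ => ‖t x.1 x.2‖ := by
  have hrow : ∀ i, Summable fun k => ‖t i k‖ := fun i =>
    Summable.of_nonneg_of_le (fun _ => norm_nonneg _) (h i) ((hb i).summable.mul_left (a i))
  rw [summable_prod_of_nonneg fun x => norm_nonneg _]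
  refine ⟨hrow, Summable.of_nonneg_of_le (fun i => tsum_nonneg fun _ => norm_nonneg _)
    (fun i => ?_) (ha.mul_right S)⟩
  exact hasSum_le (h i) (hrow i).hasSum ((hb i).mul_left (a i))

/-- Taylor coefficients of an absolutely convergent sum of power series are computed termwise. -/
theorem hasSum_coeff {ι : Type*} {t : ι → ℕ → ℂ} {h : ι → ℂ → ℂ} {g : ℂ → ℂ} {b : ℕ → ℂ}
    (hs : Summable fun x : ι × ℕ => ‖t x.1 x.2‖)
    (hrow : ∀ z i, HasSum (fun k => z ^ k * t i k) (h i z))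
    (hcol : ∀ z, HasSum (fun i => h i z) (g z))
    (hg : ∀ z, HasSum (fun k => z ^ k * b k) (g z)) (k : ℕ) :
    HasSum (fun i => t i k) (b k) := by
  have hfib : ∀ k, Summable fun i => t i k := fun k =>
    (Summable.of_norm hs).comp_injective
      (i := fun i : ι => (i, k)) (fun _ _ hab => (Prod.mk.inj hab).1)
  have h1 : ∀ z : ℂ, ‖z‖ < 1 → HasSum (fun k => z ^ k * ∑' i, t i k) (g z) := by
    intro z hz
    have hsz : Summable fun x : ι × ℕ => z ^ x.2 * t x.1 x.2 := by
      refine Summable.of_norm_bounded hs fun x => ?_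
      rw [norm_mul, norm_pow]
      exact mul_le_of_le_one_left (norm_nonneg _) (pow_le_one₀ (norm_nonneg _) hz.le)
    have h2 := hsz.hasSum.prod_fiberwise fun i => hrow z i
    rw [(hcol z).unique h2]
    exact HasSum.prod_fiberwise ((Equiv.prodComm ℕ ι).hasSum_iff.2 hsz.hasSum) fun k =>
      (hfib k).hasSum.mul_left (z ^ k)
  rw [← congrFun (eq_of_hasSum_pow h1 fun z _ => hg z) k]
  exact (hfib k).hasSum

/-- The matrix element `⟨φ|K|ψ⟩` is the sum of the normally ordered series with coefficients `f`. -/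
def HasMatrixElement (K : H →L[ℂ] H) (f : ℕ × ℕ → ℂ) (φ ψ : 𝓢(ℝ, ℂ)) : Prop :=
  HasSum (fun m : ℕ × ℕ => f m * ⟪ket ((annihilation ^ m.1) φ), ket ((annihilation ^ m.2) ψ)⟫_ℂ)
    ⟪ket φ, K (ket ψ)⟫_ℂ

theorem HasMatrixElement.swap {K : H →L[ℂ] H} {f : ℕ × ℕ → ℂ} {φ ψ : 𝓢(ℝ, ℂ)}
    (h : HasMatrixElement K f φ ψ) :
    HasMatrixElement (ContinuousLinearMap.adjoint K) (fun m => conj (f m.swap)) ψ φ := by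
  have h1 := (Equiv.prodComm ℕ ℕ).hasSum_iff.2 (h.mapL (conjCLE : ℂ →L[ℝ] ℂ))
  unfold HasMatrixElement
  rw [ContinuousLinearMap.adjoint_inner_right, ← inner_conj_symm]
  refine h1.congr_fun fun m => ?_
  simp [inner_conj_symm]

theorem hasMatrixElement_add_right {K : H →L[ℂ] H} {f : ℕ × ℕ → ℂ} {φ ψ χ : 𝓢(ℝ, ℂ)}
    (h1 : HasMatrixElement K f φ ψ) (h2 : HasMatrixElement K f φ χ) :
    HasMatrixElement K f φ (ψ + χ) := by
  unfold HasMatrixElement at *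
  rw [ket_add, map_add, inner_add_right]
  refine (h1.add h2).congr_fun fun m => ?_
  rw [map_add, ket_add, inner_add_right, mul_add]

theorem hasMatrixElement_smul_right {K : H →L[ℂ] H} {f : ℕ × ℕ → ℂ} {φ ψ : 𝓢(ℝ, ℂ)} (z : ℂ)
    (h : HasMatrixElement K f φ ψ) : HasMatrixElement K f φ (z • ψ) := by
  unfold HasMatrixElement at *
  rw [ket_smul, map_smul, inner_smul_right]
  refine (h.mul_left z).congr_fun fun m => ?_
  rw [map_smul, ket_smul, inner_smul_right, mul_left_comm]

theorem hasMatrixElement_zero_right (K : H →L[ℂ] H) (f : ℕ × ℕ → ℂ) (φ : 𝓢(ℝ, ℂ)) :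
    HasMatrixElement K f φ 0 := by
  unfold HasMatrixElement
  simp [ket_zero]

theorem hasMatrixElement_taylorState {K : H →L[ℂ] H} {f : ℕ × ℕ → ℂ} {φ : 𝓢(ℝ, ℂ)} {R : ℝ}
    (hf : ∀ r : ℝ, Summable fun m : ℕ × ℕ => ‖f m‖ * r ^ m.1)
    {C : ℝ} (hφ : ∀ n, ‖ket ((annihilation ^ n) φ)‖ ≤ C * R ^ n)
    (h : ∀ z, HasMatrixElement K f φ (expState z)) (k : ℕ) :
    HasMatrixElement K f φ (taylorState k) := by
  set t : ℕ × ℕ → ℕ → ℂ := fun m k => f m * ⟪ket ((annihilation ^ m.1) φ),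
    ket ((annihilation ^ m.2) (taylorState k))⟫_ℂ with ht
  have hb : ∀ m k, ‖t m k‖ ≤
      ‖f m‖ * R ^ m.1 * C * ‖ket ((annihilation ^ m.2) (taylorState k))‖ := by
    intro m k
    rw [ht, norm_mul, mul_assoc, mul_assoc]
    refine mul_le_mul_of_nonneg_left ((norm_inner_le_norm _ _).trans ?_) (norm_nonneg _)
    rw [← mul_assoc, mul_comm (R ^ m.1)]
    exact mul_le_mul_of_nonneg_right (hφ _) (norm_nonneg _)
  have hs : Summable fun x : (ℕ × ℕ) × ℕ => ‖t x.1 x.2‖ :=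
    summable_prod_of_norm_le ((hf R).mul_right C)
      (fun m => hasSum_norm_annihilation_pow_taylorState m.2) hb
  have hrow : ∀ (z : ℂ) (m : ℕ × ℕ), HasSum (fun k => z ^ k * t m k) (f m *
      ⟪ket ((annihilation ^ m.1) φ), ket ((annihilation ^ m.2) (expState z))⟫_ℂ) := by
    intro z m
    refine (((innerSL ℂ (ket ((annihilation ^ m.1) φ))).hasSum
      (hasSum_annihilation_pow_taylorState m.2 z)).mul_left (f m)).congr_fun fun k => ?_
    rw [ht, innerSL_apply_apply, inner_smul_right, mul_left_comm]
  have hg : ∀ z : ℂ, HasSum (fun k => z ^ k * ⟪ket φ, K (ket (taylorState k))⟫_ℂ)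
      ⟪ket φ, K (ket (expState z))⟫_ℂ := by
    intro z
    refine (((innerSL ℂ (ket φ)).comp K).hasSum (hasSum_taylorState z)).congr_fun fun k => ?_
    simp
  exact hasSum_coeff hs hrow h hg k

theorem norm_annihilation_pow_expState (u : ℂ) (n : ℕ) :
    ‖ket ((annihilation ^ n) (expState u))‖ ≤ ‖ket (expState u)‖ * ‖u‖ ^ n := by
  rw [annihilation_pow_expState, ket_smul, norm_smul, norm_pow, mul_comm]

theorem norm_annihilation_pow_taylorState (j n : ℕ) :
    ‖ket ((annihilation ^ n) (taylorState j))‖ ≤ 1 * 1 ^ n := by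
  rw [one_pow, one_mul]
  rcases lt_or_ge j n with h | h
  · rw [annihilation_pow_taylorState_of_lt h, ket_zero, norm_zero]
    exact zero_le_one
  · obtain ⟨l, rfl⟩ := Nat.exists_eq_add_of_le' h
    rw [annihilation_pow_taylorState_add]
    exact norm_taylorState_le_one l

theorem fockDomain_induction {p : 𝓢(ℝ, ℂ) → Prop} (hexp : ∀ z, p (expState z))
    (htaylor : ∀ k, p (taylorState k)) (hzero : p 0) (hadd : ∀ φ ψ, p φ → p ψ → p (φ + ψ))
    (hsmul : ∀ (z : ℂ) φ, p φ → p (z • φ)) {φ : 𝓢(ℝ, ℂ)} (hφ : φ ∈ fockDomain) : p φ := by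
  refine Submodule.span_induction ?_ hzero (fun φ ψ _ _ => hadd φ ψ) (fun z φ _ => hsmul z φ) hφ
  rintro _ (⟨k, rfl⟩ | ⟨z, rfl⟩)
  · rw [numberState_eq]
    exact hsmul _ _ (htaylor k)
  · rw [coherentState_eq]
    exact hsmul _ _ (hexp z)

/-- An operator is determined, in normally ordered form, by its matrix elements between exponential
vectors. -/
theorem isNormalOrderedForm_of_inner_expState {K : H →L[ℂ] H} {F : ℂ → ℂ → ℂ} {f : ℕ × ℕ → ℂ}
    (hf : ∀ ζ w : ℂ, HasSum (fun m : ℕ × ℕ => f m * ζ ^ m.1 * w ^ m.2) (F ζ w))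
    (hK : ∀ u z : ℂ, ⟪ket (expState u), K (ket (expState z))⟫_ℂ =
      F (conj u) z * Complex.exp (conj u * z)) : IsNormalOrderedForm K F := by
  have hf1 : ∀ r : ℝ, Summable fun m : ℕ × ℕ => ‖f m‖ * r ^ m.1 := by
    intro r
    refine Summable.of_norm ((hf r 1).summable.norm.congr fun m => ?_)
    simp
  have hf2 : ∀ r : ℝ, Summable fun m : ℕ × ℕ => ‖conj (f m.swap)‖ * r ^ m.1 := by
    intro r
    refine (Equiv.prodComm ℕ ℕ).summable_iff.1
      (Summable.of_norm ((hf 1 r).summable.norm.congr fun m => ?_))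
    simp
  have hee : ∀ u z, HasMatrixElement K f (expState u) (expState z) := by
    intro u z
    unfold HasMatrixElement
    rw [hK]
    refine ((hf (conj u) z).mul_right (Complex.exp (conj u * z))).congr_fun fun m => ?_
    rw [annihilation_pow_expState, annihilation_pow_expState, ket_smul, ket_smul,
      inner_smul_left, inner_smul_right, inner_expState, map_pow]
    ring
  have hen : ∀ u k, HasMatrixElement K f (expState u) (taylorState k) := fun u =>
    hasMatrixElement_taylorState hf1 (norm_annihilation_pow_expState u) (hee u)
  have hswap : ∀ {φ ψ}, HasMatrixElement (ContinuousLinearMap.adjoint K)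
      (fun m => conj (f m.swap)) ψ φ → HasMatrixElement K f φ ψ := by
    intro φ ψ h
    simpa using h.swap
  have hne : ∀ j z, HasMatrixElement K f (taylorState j) (expState z) := fun j z =>
    hswap (hasMatrixElement_taylorState hf2 (norm_annihilation_pow_expState z)
      (fun u => (hee u z).swap) j)
  have hnn : ∀ j k, HasMatrixElement K f (taylorState j) (taylorState k) := fun j =>
    hasMatrixElement_taylorState hf1 (norm_annihilation_pow_taylorState j) (hne j)
  have hright : ∀ {φ}, (∀ z, HasMatrixElement K f φ (expState z)) →
      (∀ k, HasMatrixElement K f φ (taylorState k)) →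
      ∀ {ψ}, ψ ∈ fockDomain → HasMatrixElement K f φ ψ := fun {φ} h1 h2 {ψ} hψ =>
    fockDomain_induction h1 h2 (hasMatrixElement_zero_right K f φ)
      (fun _ _ => hasMatrixElement_add_right) (fun z _ => hasMatrixElement_smul_right z) hψ
  refine ⟨f, hf, fun φ hφ ψ hψ => hswap ?_⟩
  exact fockDomain_induction (fun u => (hright (hee u) (hen u) hψ).swap)
    (fun j => (hright (hne j) (hnn j) hψ).swap) (hasMatrixElement_zero_right _ _ _)
    (fun _ _ => hasMatrixElement_add_right) (fun z _ => hasMatrixElement_smul_right z) hφ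

end RegionOp

theorem mainTheorem1 (c x₀ k₀ A B : ℝ) (hA : 0 ≤ A) (hB : 0 ≤ B) :
    RegionOp.IsNormalOrderedForm (RegionOp.rectangleOperator c x₀ k₀ A B)
      (fun ζ w =>
        ((c * Real.pi / 4 : ℝ) : ℂ) *
          (RegionOp.erf (-(1 / (Real.sqrt 2 : ℂ)) * (ζ + w) + x₀ + A) -
            RegionOp.erf (-(1 / (Real.sqrt 2 : ℂ)) * (ζ + w) + x₀)) *
          (RegionOp.erf (-(Complex.I / (Real.sqrt 2 : ℂ)) * (ζ - w) + k₀ + B) -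
            RegionOp.erf (-(Complex.I / (Real.sqrt 2 : ℂ)) * (ζ - w) + k₀))) ∧
    (∀ ψ : RegionOp.H,
      ((RegionOp.quasiprobabilityVolume c (RegionOp.rectangle x₀ k₀ A B) ψ : ℝ) : ℂ) =
        inner ℂ ψ (RegionOp.rectangleOperator c x₀ k₀ A B ψ)) ∧
    ∀ s t : ℝ,
      RegionOp.displacement ((s + Complex.I * t) / Real.sqrt 2) ∈
        unitary (RegionOp.H →L[ℂ] RegionOp.H) ∧
      RegionOp.displacement ((s + Complex.I * t) / Real.sqrt 2) ∘L
          RegionOp.rectangleOperator c x₀ k₀ A B ∘L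
          ContinuousLinearMap.adjoint
            (RegionOp.displacement ((s + Complex.I * t) / Real.sqrt 2)) =
        RegionOp.rectangleOperator c (x₀ + s) (k₀ + t) A B ∧
      spectrum ℂ (RegionOp.rectangleOperator c (x₀ + s) (k₀ + t) A B) =
        spectrum ℂ (RegionOp.rectangleOperator c x₀ k₀ A B) ∧
      (∀ μ : ℂ,
        Module.End.eigenspace
            (RegionOp.rectangleOperator c (x₀ + s) (k₀ + t) A B).toLinearMap μ =
          (Module.End.eigenspace
            (RegionOp.rectangleOperator c x₀ k₀ A B).toLinearMap μ).map
            (RegionOp.displacement ((s + Complex.I * t) / Real.sqrt 2)).toLinearMap) ∧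
      (∀ ψ : RegionOp.H,
        RegionOp.quasiprobabilityVolume c (RegionOp.rectangle (x₀ + s) (k₀ + t) A B)
            (RegionOp.displacement ((s + Complex.I * t) / Real.sqrt 2) ψ) =
          RegionOp.quasiprobabilityVolume c (RegionOp.rectangle x₀ k₀ A B) ψ) ∧
      RegionOp.quasiprobabilityVolume c (RegionOp.rectangle (x₀ + s) (k₀ + t) A B) ''
          {ψ : RegionOp.H | ‖ψ‖ = 1} =
        RegionOp.quasiprobabilityVolume c (RegionOp.rectangle x₀ k₀ A B) ''
          {ψ : RegionOp.H | ‖ψ‖ = 1} := by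
  refine ⟨?_, fun ψ => RegionOp.ofReal_quasiprobabilityVolume c
    (RegionOp.volume_rectangle_ne_top x₀ k₀ A B) ψ, fun s t => ?_⟩
  · obtain ⟨f, hf⟩ := RegionOp.isEntireDoubleSeries_rectangle c x₀ k₀ A B
    exact RegionOp.isNormalOrderedForm_of_inner_expState hf
      (RegionOp.inner_rectangleOperator_expState c x₀ k₀ hA hB)
  rw [RegionOp.displacement_eq]
  have hU := RegionOp.displacementQP_mem_unitary s t
  have hconj : RegionOp.displacementQP s t ∘L RegionOp.rectangleOperator c x₀ k₀ A B ∘L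
      ContinuousLinearMap.adjoint (RegionOp.displacementQP s t) =
        RegionOp.rectangleOperator c (x₀ + s) (k₀ + t) A B := by
    rw [RegionOp.adjoint_displacementQP]
    exact ContinuousLinearMap.ext (RegionOp.displacementQP_rectangleOperator c x₀ k₀ A B s t)
  have hvol := RegionOp.quasiprobabilityVolume_displacementQP c x₀ k₀ A B s t
  refine ⟨hU, hconj, ?_, ?_, hvol, ?_⟩
  · rw [← hconj]
    exact Unitary.spectrum_star_right_conjugate (R := ℂ)
      (a := RegionOp.rectangleOperator c x₀ k₀ A B) (U := ⟨_, hU⟩)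
  · exact RegionOp.eigenspace_of_conj (D' := (RegionOp.displacementQP (-s) (-t)).toLinearMap)
      (RegionOp.displacementQP_neg_comp s t) (RegionOp.displacementQP_comp_neg s t)
      (RegionOp.displacementQP_rectangleOperator c x₀ k₀ A B s t)
  · ext v
    constructor
    · rintro ⟨ψ, hψ, rfl⟩
      refine ⟨RegionOp.displacementQP (-s) (-t) ψ, ?_, ?_⟩
      · exact (RegionOp.norm_displacementQP _ _ ψ).trans hψ
      · rw [← hvol, RegionOp.displacementQP_comp_neg]
    · rintro ⟨ψ, hψ, rfl⟩
      exact ⟨RegionOp.displacementQP s t ψ, (RegionOp.norm_displacementQP _ _ ψ).trans hψ, hvol ψ⟩
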